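/- Let $(\mathbb X,\rho)$ be a non-empty locally compact metric space and let $X=\{X_t,\,t\ge 0\}$ be a time-homogeneous strong Markov process with state space $\mathbb X$ and càdlàg trajectories. Write $P_x$, $E_x$ for the distribution of $X$ started at $x\in\mathbb X$ and the corresponding expectation, $P_t(x,dy)$ for the transition function, $\|\cdot\|_{var}$ for the total variation norm $\|\varkappa\|_{var}=|\varkappa|(\mathbb X)$, and $\tau_K=\inf\{t\ge 0: X_t\in K\}$ for the hitting time of a closed set $K$ ($\inf\emptyset=+\infty$). Assume that $X$ satisfies the local Doeblin condition: for every compact $K'\subset\mathbb X$ there exists $T>0$ such that $$\sup_{x,y\in K'}\tfrac12\|P_T(x,\cdot)-P_T(y,\cdot)\|_{var}<1 .$$ Assume also that there exist a Borel function $\phi:\mathbb X\to[1,+\infty)$, a compact set $K\subset\mathbb X$ and a number $\alpha>0$ such that 1. $\phi(x)\to+\infty$ as $x\to\infty$ (that is, for every $c$ the set $\{\phi\le c\}$ is contained in a compact set); 2. $E_x\big[\phi(X_t)\mathbf 1_{\tau_K>t}\big]\le e^{-\alpha t}\phi(x)$ for all $x\in\mathbb X$ and $t\ge 0$; 3. $\sup_{x\in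 K,\,t\ge 0}E_x\big[\phi(X_t)\mathbf 1_{\phi(X_t)>c}\big]\to 0$ as $c\to+\infty$. Then $X$ admits an exponential $\phi$-coupling: there exist an invariant probability measure $\pi$ of $X$ and constants $C>0$, $\beta>0$ such that for every $x\in\mathbb X$ there is a two-component process $Z=(Z^1,Z^2)$, where $Z^1$ has the same distribution as $X$ started at $x$ and $Z^2$ has the same distribution as $X$ with initial distribution $\pi$, satisfying $$E\Big[\big(\phi(Z^1_t)+\phi(Z^2_t)\big)\mathbf 1_{Z^1_t\ne Z^2_t}\Big]\le C e^{-\beta t}\phi(x),\qquad t\ge 0 .$$ -/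

import Mathlib

open Filter Topology MeasureTheory ProbabilityTheory
open scoped NNReal ENNReal

noncomputable section

namespace PhiCoupling

section PathSpace

/-- A function of time is càdlàg: right-continuous, with left limits (in the state space). -/
def IsCadlag {E : Type*} [TopologicalSpace E] (f : ℝ≥0 → E) : Prop :=
  ∀ t, ContinuousWithinAt f (Set.Ici t) t ∧ ∃ l, Tendsto f (𝓝[<] t) (𝓝 l)

/-- The space `D([0, ∞), E)` of càdlàg trajectories in `E`. -/
def CadlagPath (E : Type*) [TopologicalSpace E] : Type _ := {f : ℝ≥0 → E // IsCadlag f}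

variable {E : Type*} [TopologicalSpace E]

instance : CoeFun (CadlagPath E) (fun _ => ℝ≥0 → E) := ⟨Subtype.val⟩

/-- The σ-algebra on the trajectories generated by the coordinates `ω ↦ ω t`. -/
instance [MeasurableSpace E] : MeasurableSpace (CadlagPath E) :=
  inferInstanceAs (MeasurableSpace {f : ℝ≥0 → E // IsCadlag f})

theorem measurable_coord [MeasurableSpace E] (t : ℝ≥0) :
    Measurable (fun ω : CadlagPath E => ω t) :=
  (measurable_pi_apply t).comp measurable_subtype_coe

theorem IsCadlag.shift {f : ℝ≥0 → E} (hf : IsCadlag f) (s : ℝ≥0) :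
    IsCadlag (fun t => f (s + t)) := by
  have hc : Continuous (fun t : ℝ≥0 => s + t) := by fun_prop
  intro t
  refine ⟨?_, ?_⟩
  · refine (hf (s + t)).1.comp hc.continuousWithinAt ?_
    intro u hu
    exact add_le_add_right (Set.mem_Ici.1 hu) s
  · obtain ⟨l, hl⟩ := (hf (s + t)).2
    refine ⟨l, hl.comp ?_⟩
    refine tendsto_nhdsWithin_of_tendsto_nhds_of_eventually_within _
      ((hc.tendsto t).mono_left nhdsWithin_le_nhds) ?_
    filter_upwards [self_mem_nhdsWithin] with u hu
    exact add_lt_add_right (Set.mem_Iio.1 hu) s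

/-- The time shift `(θ_s ω) t = ω (s + t)`. -/
def CadlagPath.shift (s : ℝ≥0) (ω : CadlagPath E) : CadlagPath E :=
  ⟨fun t => ω (s + t), IsCadlag.shift ω.2 s⟩

/-- The σ-algebra generated by the trajectory up to time `t`. -/
@[reducible] def pastSigma [MeasurableSpace E] (t : ℝ≥0) : MeasurableSpace (CadlagPath E) :=
  ⨆ s : Set.Iic t, MeasurableSpace.comap (fun ω : CadlagPath E => ω s) inferInstance

theorem pastSigma_le [MeasurableSpace E] (t : ℝ≥0) :
    pastSigma t ≤ (inferInstance : MeasurableSpace (CadlagPath E)) :=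
  iSup_le fun s => (measurable_coord (s : ℝ≥0)).comap_le

/-- The natural filtration of the coordinate process, completed by the `P`-null sets; its ambient
σ-algebra is the `P`-completion of the σ-algebra of the path space. -/
def completedFiltration [MeasurableSpace E] (P : Measure (CadlagPath E)) :
    Filtration ℝ≥0 (eventuallyMeasurableSpace
      (inferInstance : MeasurableSpace (CadlagPath E)) (ae P)) where
  seq t := eventuallyMeasurableSpace (pastSigma t) (ae P)
  mono' := by
    intro s t hst A hA
    obtain ⟨B, hB, hAB⟩ := hA
    refine ⟨B, ?_, hAB⟩
    have h : pastSigma (E := E) s ≤ pastSigma t :=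
      iSup_le fun u => le_iSup (fun v : Set.Iic t =>
        MeasurableSpace.comap (fun ω : CadlagPath E => ω v) inferInstance)
        ⟨u.1, le_trans u.2 hst⟩
    exact h B hB
  le' := by
    intro t A hA
    obtain ⟨B, hB, hAB⟩ := hA
    exact ⟨B, pastSigma_le t B hB, hAB⟩

end PathSpace

/-- A time-homogeneous strong Markov process with càdlàg trajectories in `E`, given by the
distributions `law x = P_x` of its trajectory when started from `x`. The strong Markov property is
`P_x(A, τ < ∞, θ_τ ω ∈ B) = E_x[1_A 1_{τ < ∞} P_{ω(τ)}(B)]` for all stopping times `τ`, all `A` in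
the σ-algebra of events prior to `τ`, and all measurable sets `B` of trajectories. -/
structure StrongMarkovProcess (E : Type*) [TopologicalSpace E] [MeasurableSpace E] where
  law : Kernel E (CadlagPath E)
  isMarkovKernel : IsMarkovKernel law
  start : ∀ x, ∀ᵐ ω ∂(law x), ω 0 = x
  strongMarkov : ∀ (x : E) (τ : CadlagPath E → WithTop ℝ≥0)
    (hτ : IsStoppingTime (completedFiltration (law x)) τ)
    (A : Set (CadlagPath E)), MeasurableSet[hτ.measurableSpace] A →
    ∀ B : Set (CadlagPath E), MeasurableSet B →
      law x (A ∩ {ω | τ ω < ⊤} ∩ {ω | ω.shift ((τ ω).untopD 0) ∈ B}) =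
        ∫⁻ ω in A ∩ {ω | τ ω < ⊤}, law (ω ((τ ω).untopD 0)) B ∂(law x)

variable {E : Type*} [TopologicalSpace E] [MeasurableSpace E]

namespace StrongMarkovProcess

/-- The transition function `P_t(x, dy)`. -/
def transition (X : StrongMarkovProcess E) (t : ℝ≥0) : Kernel E E :=
  X.law.map (fun ω => ω t)

instance (X : StrongMarkovProcess E) : IsMarkovKernel X.law := X.isMarkovKernel

instance (X : StrongMarkovProcess E) (t : ℝ≥0) : IsMarkovKernel (X.transition t) :=
  Kernel.IsMarkovKernel.map _ (measurable_coord t)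

/-- The distribution of the trajectory when the initial value has distribution `μ`. -/
def lawFrom (X : StrongMarkovProcess E) (μ : Measure E) : Measure (CadlagPath E) :=
  μ.bind X.law

/-- `μ` is an invariant probability measure: `μ_t = ∫ P_t(x, ·) μ(dx)` equals `μ` for all `t`. -/
def IsInvariant (X : StrongMarkovProcess E) (μ : Measure E) : Prop :=
  IsProbabilityMeasure μ ∧ ∀ t, μ.bind (X.transition t) = μ

/-- The law `Q` of a pair of trajectories is a `(μ, ν)`-coupling for the process. -/
def IsCoupling (X : StrongMarkovProcess E) (μ ν : Measure E)
    (Q : Measure (CadlagPath E × CadlagPath E)) : Prop :=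
  Q.map Prod.fst = X.lawFrom μ ∧ Q.map Prod.snd = X.lawFrom ν

/-- The total variation norm `|μ - ν|(E)` of the signed measure `μ - ν`. -/
def varDist (μ ν : Measure E) [IsFiniteMeasure μ] [IsFiniteMeasure ν] : ℝ≥0∞ :=
  (μ.toSignedMeasure - ν.toSignedMeasure).totalVariation Set.univ

/-- The Doeblin coefficient `ϰ(T, K) = sup_{x, y ∈ K} (1/2) ‖P_T(x, ·) - P_T(y, ·)‖_var`. -/
def doeblinCoeff (X : StrongMarkovProcess E) (T : ℝ≥0) (K : Set E) : ℝ≥0∞ :=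
  ⨆ x ∈ K, ⨆ y ∈ K, varDist (X.transition T x) (X.transition T y) / 2

/-- The local Doeblin condition. -/
def LocalDoeblin (X : StrongMarkovProcess E) : Prop :=
  ∀ K : Set E, IsCompact K → ∃ T : ℝ≥0, 0 < T ∧ X.doeblinCoeff T K < 1

/-- The process admits an exponential `φ`-coupling. -/
def AdmitsExpCoupling (X : StrongMarkovProcess E) (φ : E → ℝ) : Prop :=
  ∃ π : Measure E, X.IsInvariant π ∧ ∃ C β : ℝ, 0 < C ∧ 0 < β ∧
    ∀ x : E, ∃ Q : Measure (CadlagPath E × CadlagPath E),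
      X.IsCoupling (Measure.dirac x) π Q ∧
      ∀ t : ℝ≥0,
        ∫⁻ z, {z | z.1 t ≠ z.2 t}.indicator
            (fun z => ENNReal.ofReal (φ (z.1 t) + φ (z.2 t))) z ∂Q
          ≤ ENNReal.ofReal (C * Real.exp (-β * t) * φ x)

end StrongMarkovProcess

/-- The hitting time `τ_K = inf {t ≥ 0 : ω t ∈ K}` (`⊤` if `K` is never hit). -/
def hitTime (K : Set E) : CadlagPath E → WithTop ℝ≥0 :=
  hittingAfter (fun t ω => ω t) K 0

end PhiCoupling

end

noncomputable section

namespace PhiCoupling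

/-! ### Cutting, gluing and concatenating trajectories. -/

section PathOperations

variable {E : Type*} [TopologicalSpace E]

/-! The proof is a Harris-type argument in the weighted form of Hairer and Mattingly, carried out on
trajectories instead of transition kernels.

Drift. Hypothesis 3 bounds `E_y φ(X_s)` by some `M`, uniformly in `y ∈ K` and `s`. The strong Markov
property at the hitting time of `K`, combined with hypothesis 2, gives `E_x φ(X_t) ≤ e^{-αt} φ(x) +
M` (`lintegral_transition_le`).

Contraction. For a suitable `T`, two trajectories are coupled over `[0, T]`: identically if they
start at the same point, and otherwise so that their positions at `T` are maximally coupled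
(`exists_stepCoupling`). Let `D(x, y) = 2 + β(φ(x) + φ(y))` off the diagonal and `0` on it. If `φ(x)
+ φ(y)` is large, the drift alone contracts `D` on average. Otherwise both points lie in a sublevel
set of `φ`, contained in a compact set, and the local Doeblin condition contracts the constant `2`,
while a small `β` keeps the drift constant harmless. Iterating the step gives geometric decay of the
mean of `D` (`exists_geometric_coupling`).

Invariant measure. The coupling bounds `|P_t(x, B) - P_t(y, B)|` by a decaying factor times `φ(x) +
φ(y)`. Hence the laws `P_n(x₀, ·)` are Cauchy uniformly over measurable sets, and their limit `π` is
invariant with a finite `φ`-moment (`exists_isInvariant`). No Feller property is involved. Averaging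
the coupling from `(x, y)` over `y ~ π` gives the result (`admitsExpCoupling_of_geometric`).

Two measurability facts support this. The path space is standard Borel, which provides conditional
laws given the position at `T`; it is proved by restricting trajectories to rational times. The
hitting time of a closed set is a stopping time of the completed filtration, because analytic sets
are universally measurable. Both use that the state space is Polish, which follows from local
compactness and the growth of `φ`. -/

@[ext] theorem CadlagPath.ext {ω ω' : CadlagPath E} (h : ∀ t, ω t = ω' t) : ω = ω' :=
  Subtype.ext (funext h)

/-- Being càdlàg is a local property. -/
theorem isCadlag_of_locally_eq {f : ℝ≥0 → E}
    (h : ∀ t, ∃ g, IsCadlag g ∧ ∃ u, t < u ∧ Set.EqOn f g (Set.Iio u)) : IsCadlag f := by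
  intro t
  obtain ⟨g, hg, u, htu, hfg⟩ := h t
  refine ⟨(hg t).1.congr_of_eventuallyEq ?_ (hfg htu), ?_⟩
  · exact mem_nhdsWithin_of_mem_nhds (mem_of_superset (Iio_mem_nhds htu) hfg)
  · obtain ⟨l, hl⟩ := (hg t).2
    refine ⟨l, hl.congr' ?_⟩
    exact mem_nhdsWithin_of_mem_nhds
      (mem_of_superset (Iio_mem_nhds htu) fun s hs => (hfg hs).symm)

theorem isCadlag_const (x : E) : IsCadlag (fun _ => x) := fun _ =>
  ⟨continuousWithinAt_const, x, tendsto_const_nhds⟩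

/-- The trajectory that stays at `x`. -/
def CadlagPath.const (x : E) : CadlagPath E := ⟨fun _ => x, isCadlag_const x⟩

theorem IsCadlag.glue {f g : ℝ≥0 → E} (hf : IsCadlag f) (hg : IsCadlag g) (s : ℝ≥0) :
    IsCadlag (fun t => if t < s then f t else g (t - s)) := by
  intro t
  have hc : Continuous (fun t : ℝ≥0 => t - s) := by fun_prop
  constructor
  · rcases lt_or_ge t s with hts | hst
    · refine (hf t).1.congr_of_eventuallyEq ?_ (by simp [hts])
      exact mem_nhdsWithin_of_mem_nhds
        (mem_of_superset (Iio_mem_nhds hts) fun u (hu : u < s) => by simp [hu])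
    · have h1 : ContinuousWithinAt (fun t => g (t - s)) (Set.Ici t) t := by
        refine ContinuousWithinAt.comp (f := fun t => t - s) (hg (t - s)).1
          hc.continuousWithinAt ?_
        intro u hu
        exact tsub_le_tsub_right (Set.mem_Ici.1 hu) s
      refine h1.congr (fun u hu => ?_) (by simp [hst.not_gt])
      simp [(hst.trans hu).not_gt]
  -- The junction `t = s` belongs to `f` for left limits, whereas for right-continuity it belongs to
  -- `g`.
  · rcases le_or_gt t s with hts | hst
    · obtain ⟨l, hl⟩ := (hf t).2
      refine ⟨l, hl.congr' ?_⟩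
      filter_upwards [self_mem_nhdsWithin] with u hu
      simp [(Set.mem_Iio.1 hu).trans_le hts]
    · obtain ⟨l, hl⟩ := (hg (t - s)).2
      refine ⟨l, ?_⟩
      have h1 : Tendsto (fun u : ℝ≥0 => u - s) (𝓝[<] t) (𝓝[<] (t - s)) := by
        refine tendsto_nhdsWithin_of_tendsto_nhds_of_eventually_within _
          ((hc.tendsto t).mono_left nhdsWithin_le_nhds) ?_
        filter_upwards [self_mem_nhdsWithin] with u hu
        exact tsub_lt_tsub_right_of_lt' (Set.mem_Iio.1 hu) hst
      refine (hl.comp h1).congr' ?_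
      filter_upwards [mem_nhdsWithin_of_mem_nhds (Ioi_mem_nhds hst)] with u hu
      simp [(Set.mem_Ioi.1 hu).not_gt]
where
  tsub_lt_tsub_right_of_lt' {a b s : ℝ≥0} (h : a < b) (hs : s < b) : a - s < b - s := by
    rcases le_total s a with h1 | h1
    · exact tsub_lt_tsub_right_of_le h1 h
    · rw [tsub_eq_zero_of_le h1]; exact tsub_pos_of_lt hs

/-- Follow `ω` before time `s` and then restart with `ω'`. -/
def CadlagPath.glue (s : ℝ≥0) (ω ω' : CadlagPath E) : CadlagPath E :=
  ⟨fun t => if t < s then ω t else ω' (t - s), ω.2.glue ω'.2 s⟩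

theorem CadlagPath.glue_of_lt {s t : ℝ≥0} (h : t < s) (ω ω' : CadlagPath E) :
    CadlagPath.glue s ω ω' t = ω t := if_pos h

theorem CadlagPath.glue_of_le {s t : ℝ≥0} (h : s ≤ t) (ω ω' : CadlagPath E) :
    CadlagPath.glue s ω ω' t = ω' (t - s) := if_neg h.not_gt

/-- The trajectory frozen at time `s`. -/
def CadlagPath.stopAt (s : ℝ≥0) (ω : CadlagPath E) : CadlagPath E :=
  CadlagPath.glue s ω (CadlagPath.const (ω s))

theorem CadlagPath.stopAt_apply (s : ℝ≥0) (ω : CadlagPath E) (t : ℝ≥0) :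
    CadlagPath.stopAt s ω t = ω (min t s) := by
  rcases lt_or_ge t s with h | h
  · rw [CadlagPath.stopAt, CadlagPath.glue_of_lt h, min_eq_left h.le]
  · rw [CadlagPath.stopAt, CadlagPath.glue_of_le h, min_eq_right h]; rfl

theorem CadlagPath.glue_stopAt_shift (s : ℝ≥0) (ω : CadlagPath E) :
    CadlagPath.glue s (ω.stopAt s) (ω.shift s) = ω := by
  ext t
  rcases lt_or_ge t s with h | h
  · rw [CadlagPath.glue_of_lt h, CadlagPath.stopAt_apply, min_eq_left h.le]
  · rw [CadlagPath.glue_of_le h]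
    change ω (s + (t - s)) = ω t
    rw [add_tsub_cancel_of_le h]

theorem CadlagPath.glue_stopAt (s : ℝ≥0) (ω ω' : CadlagPath E) :
    CadlagPath.glue s (ω.stopAt s) ω' = CadlagPath.glue s ω ω' := by
  ext t
  rcases lt_or_ge t s with h | h
  · rw [CadlagPath.glue_of_lt h, CadlagPath.stopAt_apply, min_eq_left h.le, CadlagPath.glue_of_lt h]
  · rw [CadlagPath.glue_of_le h, CadlagPath.glue_of_le h]

/-- Concatenation of the first `n + 1` trajectories of a sequence, each of them being followed
for a time `T`, the last one forever. -/
def concatUpTo (T : ℝ≥0) (w : ℕ → CadlagPath E) : ℕ → CadlagPath E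
  | 0 => w 0
  | n + 1 => CadlagPath.glue ((n + 1 : ℕ) * T) (concatUpTo T w n) (w (n + 1))

theorem concatUpTo_apply_of_lt (T : ℝ≥0) (w : ℕ → CadlagPath E) {m n : ℕ} (hmn : m ≤ n)
    {t : ℝ≥0} (ht : t < (m + 1 : ℕ) * T) : concatUpTo T w n t = concatUpTo T w m t := by
  induction n, hmn using Nat.le_induction with
  | base => rfl
  | succ n hmn ih =>
    rw [concatUpTo, CadlagPath.glue_of_lt, ih]
    refine ht.trans_le ?_
    gcongr

theorem concatUpTo_apply_of_le (T : ℝ≥0) (w : ℕ → CadlagPath E) (n : ℕ)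
    {t : ℝ≥0} (ht : n * T ≤ t) : concatUpTo T w n t = w n (t - n * T) := by
  cases n with
  | zero => simp [concatUpTo]
  | succ n => rw [concatUpTo, CadlagPath.glue_of_le ht]

theorem lt_floor_div_add_one_mul {T : ℝ≥0} (hT : 0 < T) (t : ℝ≥0) :
    t < (⌊t / T⌋₊ + 1 : ℕ) * T := by
  rw [← div_lt_iff₀ hT]
  exact_mod_cast Nat.lt_floor_add_one (t / T)

theorem floor_div_mul_le {T : ℝ≥0} (hT : 0 < T) (t : ℝ≥0) : (⌊t / T⌋₊ : ℝ≥0) * T ≤ t := by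
  rw [← le_div_iff₀ hT]
  exact Nat.floor_le zero_le

theorem concatUpTo_eq_floor {T : ℝ≥0} (hT : 0 < T) (w : ℕ → CadlagPath E) {n : ℕ} {t : ℝ≥0}
    (ht : t < (n + 1 : ℕ) * T) : concatUpTo T w ⌊t / T⌋₊ t = concatUpTo T w n t := by
  refine (concatUpTo_apply_of_lt T w ?_ (lt_floor_div_add_one_mul hT t)).symm
  rw [← div_lt_iff₀ hT] at ht
  exact Nat.lt_succ_iff.1 ((Nat.floor_lt zero_le).2 ht)

/-- Concatenation of a sequence of trajectories, each of them being followed for a time `T`. -/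
def concat (T : ℝ≥0) (hT : 0 < T) (w : ℕ → CadlagPath E) : CadlagPath E :=
  ⟨fun t => concatUpTo T w ⌊t / T⌋₊ t, isCadlag_of_locally_eq fun t =>
    ⟨_, (concatUpTo T w ⌊t / T⌋₊).2, _, lt_floor_div_add_one_mul hT t,
      fun _ hs => concatUpTo_eq_floor hT w hs⟩⟩

theorem concat_apply_of_lt {T : ℝ≥0} (hT : 0 < T) (w : ℕ → CadlagPath E) {n : ℕ} {t : ℝ≥0}
    (ht : t < (n + 1 : ℕ) * T) : concat T hT w t = concatUpTo T w n t :=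
  concatUpTo_eq_floor hT w ht

theorem concat_apply {T : ℝ≥0} (hT : 0 < T) (w : ℕ → CadlagPath E) (t : ℝ≥0) :
    concat T hT w t = w ⌊t / T⌋₊ (t - ⌊t / T⌋₊ * T) :=
  concatUpTo_apply_of_le T w _ (floor_div_mul_le hT t)

theorem stopAt_concat {T : ℝ≥0} (hT : 0 < T) (w : ℕ → CadlagPath E) (n : ℕ) {s : ℝ≥0}
    (hs : s < (n + 1 : ℕ) * T) :
    (concat T hT w).stopAt s = (concatUpTo T w n).stopAt s := by
  ext t
  rw [CadlagPath.stopAt_apply, CadlagPath.stopAt_apply, concat_apply_of_lt hT]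
  exact (min_le_right _ _).trans_lt hs

end PathOperations

/-! ### Measurability of the operations on trajectories. -/

section PathMeasurability

variable {E : Type*} [TopologicalSpace E] [MeasurableSpace E] {A : Type*} [MeasurableSpace A]

theorem measurable_cadlagPath_iff {f : A → CadlagPath E} :
    Measurable f ↔ ∀ t, Measurable (fun a => f a t) := by
  refine ⟨fun h t => (measurable_coord t).comp h, fun h => ?_⟩
  exact Measurable.subtype_mk (measurable_pi_iff.2 h)

theorem le_of_measurable_coord {m : MeasurableSpace (CadlagPath E)}
    (h : ∀ t, Measurable[m] (fun ω : CadlagPath E => ω t)) : instMeasurableSpaceCadlagPath ≤ m :=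
  fun _ hB => ((@measurable_cadlagPath_iff E _ _ _ m (fun ω => ω)).2 h :
    @Measurable _ _ m instMeasurableSpaceCadlagPath (fun ω => ω)) hB

theorem measurable_const_path : Measurable (CadlagPath.const : E → CadlagPath E) :=
  measurable_cadlagPath_iff.2 fun _ => measurable_id

theorem measurable_glue (s : ℝ≥0) :
    Measurable (fun p : CadlagPath E × CadlagPath E => CadlagPath.glue s p.1 p.2) := by
  refine measurable_cadlagPath_iff.2 fun t => ?_
  rcases lt_or_ge t s with h | h
  · simp_rw [CadlagPath.glue_of_lt h]
    exact (measurable_coord t).comp measurable_fst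
  · simp_rw [CadlagPath.glue_of_le h]
    exact (measurable_coord _).comp measurable_snd

theorem measurable_stopAt (s : ℝ≥0) : Measurable (CadlagPath.stopAt s : CadlagPath E → _) := by
  refine measurable_cadlagPath_iff.2 fun t => ?_
  simp_rw [CadlagPath.stopAt_apply]
  exact measurable_coord _

theorem measurable_stopAt_pastSigma (s : ℝ≥0) :
    Measurable[pastSigma s] (CadlagPath.stopAt s : CadlagPath E → _) := by
  refine (@measurable_cadlagPath_iff E _ _ (CadlagPath E) (pastSigma s) _).2 fun t => ?_
  simp_rw [CadlagPath.stopAt_apply]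
  refine Measurable.mono (comap_measurable _) ?_ le_rfl
  exact le_iSup (fun v : Set.Iic s =>
    MeasurableSpace.comap (fun ω : CadlagPath E => ω v) inferInstance)
      ⟨min t s, Set.mem_Iic.2 (min_le_right _ _)⟩

theorem measurable_shift (s : ℝ≥0) : Measurable (CadlagPath.shift s : CadlagPath E → _) :=
  measurable_cadlagPath_iff.2 fun t => measurable_coord (s + t)

theorem measurable_concatUpTo (T : ℝ≥0) (n : ℕ) :
    Measurable (fun w : ℕ → CadlagPath E => concatUpTo T w n) := by
  induction n with
  | zero => exact measurable_pi_apply 0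
  | succ n ih => exact (measurable_glue _).comp (ih.prodMk (measurable_pi_apply (n + 1)))

theorem measurable_concat (T : ℝ≥0) (hT : 0 < T) :
    Measurable (concat T hT : (ℕ → CadlagPath E) → _) :=
  measurable_cadlagPath_iff.2 fun t =>
    show Measurable (fun w => concatUpTo T w ⌊t / T⌋₊ t) from
      (measurable_coord t).comp (measurable_concatUpTo T ⌊t / T⌋₊)

/-- A finite measure on trajectories is determined by its images under stopping at large times. -/
theorem measure_ext_of_stopAt {P Q : Measure (CadlagPath E)} [IsFiniteMeasure P]
    (s : ℕ → ℝ≥0) (hs : Tendsto s atTop atTop) (hmono : Monotone s)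
    (h : ∀ n, P.map (CadlagPath.stopAt (s n)) = Q.map (CadlagPath.stopAt (s n))) : P = Q := by
  let C : Set (Set (CadlagPath E)) :=
    {A | ∃ n B, MeasurableSet B ∧ A = CadlagPath.stopAt (s n) ⁻¹' B}
  have key : ∀ {m n} {B : Set (CadlagPath E)}, m ≤ n →
      CadlagPath.stopAt (s m) ⁻¹' B =
        CadlagPath.stopAt (s n) ⁻¹' (CadlagPath.stopAt (s m) ⁻¹' B) := by
    intro m n B hmn
    ext ω
    have : CadlagPath.stopAt (s m) (CadlagPath.stopAt (s n) ω) = CadlagPath.stopAt (s m) ω := by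
      ext t
      simp only [CadlagPath.stopAt_apply]
      rw [min_assoc, min_eq_left (hmono hmn)]
    simp [this]
  have huniv : P Set.univ = Q Set.univ := by
    have := congrArg (fun μ => μ Set.univ) (h 0)
    simpa [Measure.map_apply (measurable_stopAt _) MeasurableSet.univ] using this
  refine ext_of_generate_finite C ?_ ?_ ?_ huniv
  · refine le_antisymm ?_ ?_
    · refine le_of_measurable_coord fun t => ?_
      obtain ⟨n, hn⟩ := (hs.eventually_ge_atTop t).exists
      intro B hB
      refine MeasurableSpace.measurableSet_generateFrom
        ⟨n, (fun ω : CadlagPath E => ω t) ⁻¹' B, measurable_coord t hB, ?_⟩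
      ext ω
      simp [CadlagPath.stopAt_apply, min_eq_left hn]
    · refine MeasurableSpace.generateFrom_le ?_
      rintro A ⟨n, B, hB, rfl⟩
      exact measurable_stopAt _ hB
  · rintro A ⟨m, B, hB, rfl⟩ A' ⟨n, B', hB', rfl⟩ -
    refine ⟨max m n, CadlagPath.stopAt (s m) ⁻¹' B ∩ CadlagPath.stopAt (s n) ⁻¹' B',
      (measurable_stopAt _ hB).inter (measurable_stopAt _ hB'), ?_⟩
    rw [Set.preimage_inter, ← key (le_max_left m n), ← key (le_max_right m n)]
  · rintro A ⟨n, B, hB, rfl⟩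
    rw [← Measure.map_apply (measurable_stopAt _) hB, h n,
      Measure.map_apply (measurable_stopAt _) hB]

variable [TopologicalSpace.PseudoMetrizableSpace E] [BorelSpace E]

/-- Joint measurability comes from right-continuity: `t` is approximated from the right by grid
points `u n t`, and evaluation at a time taking countably many values is measurable. -/
theorem measurable_eval : Measurable (fun p : ℝ≥0 × CadlagPath E => p.2 p.1) := by
  let u : ℕ → ℝ≥0 → ℝ≥0 := fun n t => (⌊t * (n + 1 : ℝ≥0)⌋₊ + 1 : ℕ) / (n + 1 : ℝ≥0)
  have hpos : ∀ n : ℕ, (0 : ℝ≥0) < n + 1 := fun n => by positivity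
  have hge : ∀ n t, t ≤ u n t := by
    intro n t
    rw [le_div_iff₀ (hpos n)]
    exact_mod_cast (Nat.lt_floor_add_one (t * (n + 1 : ℝ≥0))).le
  have hle : ∀ n t, u n t ≤ t + 1 / (n + 1 : ℝ≥0) := by
    intro n t
    rw [div_le_iff₀ (hpos n), add_mul, div_mul_cancel₀ _ (hpos n).ne']
    push_cast
    gcongr
    exact Nat.floor_le zero_le
  have hlim : ∀ t, Tendsto (fun n => u n t) atTop (𝓝[≥] t) := by
    intro t
    refine tendsto_nhdsWithin_of_tendsto_nhds_of_eventually_within _ ?_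
      (Eventually.of_forall fun n => hge n t)
    refine tendsto_of_tendsto_of_tendsto_of_le_of_le tendsto_const_nhds ?_
      (fun n => hge n t) (fun n => hle n t)
    simpa using (tendsto_const_nhds (x := t)).add
      (tendsto_one_div_add_atTop_nhds_zero_nat (𝕜 := ℝ≥0))
  refine measurable_of_tendsto_metrizable (f := fun n p => p.2 (u n p.1)) (fun n => ?_) ?_
  · have h1 : Measurable (fun q : ℕ × CadlagPath E => q.2 ((q.1 + 1 : ℕ) / (n + 1 : ℝ≥0))) :=
      measurable_from_prod_countable_right fun k =>
        measurable_coord ((k + 1 : ℕ) / (n + 1 : ℝ≥0))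
    have h2 : Measurable (fun p : ℝ≥0 × CadlagPath E => ⌊p.1 * (n + 1 : ℝ≥0)⌋₊) :=
      Nat.measurable_floor.comp (by fun_prop)
    exact h1.comp (h2.prodMk measurable_snd)
  · rw [tendsto_pi_nhds]
    intro p
    exact ((p.2.2 p.1).1.tendsto).comp (hlim p.1)

theorem measurable_shift_uncurry :
    Measurable (fun p : ℝ≥0 × CadlagPath E => p.2.shift p.1) :=
  measurable_cadlagPath_iff.2 fun t => measurable_eval.comp
    ((measurable_fst.add_const t).prodMk measurable_snd)

end PathMeasurability

/-! ### The path space over a Polish space is standard Borel. -/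

section StandardBorel

theorem exists_nnrat_btwn {a b : ℝ≥0} (h : a < b) : ∃ q : ℚ≥0, a < (q : ℝ≥0) ∧ (q : ℝ≥0) < b := by
  obtain ⟨q, hq, h1, h2⟩ := (NNReal.lt_iff_exists_rat_btwn a b).1 h
  lift q to ℚ≥0 using hq
  have : (q : ℝ≥0) = Real.toNNReal (q : ℚ) := by
    rw [← NNReal.coe_inj, Real.coe_toNNReal _ (by positivity)]
    change (q : ℝ) = ((q : ℚ) : ℝ)
    simp
  exact ⟨q, by rwa [this], by rwa [this]⟩

/-- The rational times approaching `t` from the right. -/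
def rationalsRight (t : ℝ≥0) : Filter ℚ≥0 := comap (fun q : ℚ≥0 => (q : ℝ≥0)) (𝓝[>] t)

/-- The rational times approaching `t` from the left. -/
def rationalsLeft (t : ℝ≥0) : Filter ℚ≥0 := comap (fun q : ℚ≥0 => (q : ℝ≥0)) (𝓝[<] t)

theorem eventually_rationalsRight {t : ℝ≥0} {p : ℚ≥0 → Prop} :
    (∀ᶠ q in rationalsRight t, p q) ↔ ∃ u, t < u ∧ ∀ q : ℚ≥0, t < q → (q : ℝ≥0) < u → p q := by
  rw [rationalsRight, eventually_comap, Filter.Eventually, mem_nhdsGT_iff_exists_Ioo_subset]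
  constructor
  · rintro ⟨u, hu, h⟩
    exact ⟨u, hu, fun q h1 h2 => h ⟨h1, h2⟩ q rfl⟩
  · rintro ⟨u, hu, h⟩
    refine ⟨u, hu, ?_⟩
    rintro s ⟨h1, h2⟩ q rfl
    exact h q h1 h2

theorem eventually_rationalsLeft {t : ℝ≥0} (ht : 0 < t) {p : ℚ≥0 → Prop} :
    (∀ᶠ q in rationalsLeft t, p q) ↔ ∃ u, u < t ∧ ∀ q : ℚ≥0, u < q → (q : ℝ≥0) < t → p q := by
  rw [rationalsLeft, eventually_comap, Filter.Eventually, mem_nhdsLT_iff_exists_Ioo_subset' ht]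
  constructor
  · rintro ⟨u, hu, h⟩
    exact ⟨u, hu, fun q h1 h2 => h ⟨h1, h2⟩ q rfl⟩
  · rintro ⟨u, hu, h⟩
    refine ⟨u, hu, ?_⟩
    rintro s ⟨h1, h2⟩ q rfl
    exact h q h1 h2

instance neBot_rationalsRight (t : ℝ≥0) : (rationalsRight t).NeBot := by
  rw [neBot_iff, ne_eq, ← eventually_false_iff_eq_bot, eventually_rationalsRight]
  rintro ⟨u, hu, h⟩
  obtain ⟨q, h1, h2⟩ := exists_nnrat_btwn hu
  exact h q h1 h2

theorem neBot_rationalsLeft {t : ℝ≥0} (ht : 0 < t) : (rationalsLeft t).NeBot := by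
  rw [neBot_iff, ne_eq, ← eventually_false_iff_eq_bot, eventually_rationalsLeft ht]
  rintro ⟨u, hu, h⟩
  obtain ⟨q, h1, h2⟩ := exists_nnrat_btwn hu
  exact h q h1 h2

theorem CadlagPath.tendsto_rationalsRight {E : Type*} [TopologicalSpace E] (ω : CadlagPath E)
    (t : ℝ≥0) : Tendsto (fun q : ℚ≥0 => ω q) (rationalsRight t) (𝓝 (ω t)) :=
  ((ω.2 t).1.tendsto.mono_left (nhdsWithin_mono _ Set.Ioi_subset_Ici_self)).comp tendsto_comap

variable {E : Type*} [MetricSpace E]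

/-- A function on the rational times is a restriction of a càdlàg trajectory if and only if it has
boundedly many oscillations on bounded intervals and is right-continuous. -/
def IsRationalCadlag (f : ℚ≥0 → E) : Prop :=
  (∀ N k : ℕ, ∃ m : ℕ, ∀ q : Fin (m + 1) → ℚ≥0, StrictMono q → (∀ i, q i ≤ N) →
    ∃ i : Fin m, dist (f (q i.castSucc)) (f (q i.succ)) ≤ 1 / (k + 1)) ∧
  ∀ (q : ℚ≥0) (k : ℕ), ∃ j : ℕ, ∀ r : ℚ≥0, q < r → r < q + 1 / (j + 1) →
    dist (f r) (f q) ≤ 1 / (k + 1)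

/-- Near each `t`, right-continuity gives a small oscillation on some `[t, u)` and the left limit
gives one on some `(v, t)`; compactness leaves finitely many such pieces. The pieces are
order-connected so that a pigeonhole argument can later be applied to consecutive times. -/
theorem exists_oscillation_cover {f : ℝ≥0 → E} (hf : IsCadlag f) (N : ℝ≥0) {ε : ℝ} (hε : 0 < ε) :
    ∃ C : Set (Set ℝ≥0), C.Finite ∧ Set.Icc 0 N ⊆ ⋃₀ C ∧
      ∀ c ∈ C, c.OrdConnected ∧ ∀ s ∈ c, ∀ t ∈ c, dist (f s) (f t) ≤ ε := by
  refine (isCompact_Icc (a := (0 : ℝ≥0)) (b := N)).induction_on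
    (p := fun K => ∃ C : Set (Set ℝ≥0), C.Finite ∧ K ⊆ ⋃₀ C ∧
      ∀ c ∈ C, c.OrdConnected ∧ ∀ s ∈ c, ∀ t ∈ c, dist (f s) (f t) ≤ ε) ?_ ?_ ?_ ?_
  · exact ⟨∅, Set.finite_empty, by simp, by simp⟩
  · rintro s t hst ⟨C, h1, h2, h3⟩
    exact ⟨C, h1, hst.trans h2, h3⟩
  · rintro s t ⟨C, h1, h2, h3⟩ ⟨C', h1', h2', h3'⟩
    refine ⟨C ∪ C', h1.union h1', ?_, ?_⟩
    · rw [Set.sUnion_union]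
      exact Set.union_subset_union h2 h2'
    · rintro c (hc | hc)
      exacts [h3 c hc, h3' c hc]
  · intro t _
    have hsmall : ∀ l : E, Metric.ball l (ε / 2) ∈ 𝓝 l := fun l =>
      Metric.ball_mem_nhds l (by positivity)
    have hball : ∀ {l x y : E}, x ∈ Metric.ball l (ε / 2) → y ∈ Metric.ball l (ε / 2) →
        dist x y ≤ ε := by
      intro l x y hx hy
      have := dist_triangle_right x y l
      rw [Metric.mem_ball] at hx hy
      linarith
    obtain ⟨l, hl⟩ := (hf t).2
    have hR := (hf t).1.tendsto (hsmall (f t))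
    have hL := hl (hsmall l)
    rw [mem_map] at hR hL
    obtain ⟨u, hu, hRu⟩ := mem_nhdsGE_iff_exists_Ico_subset.1 hR
    rcases eq_or_lt_of_le (zero_le (a := t)) with h0 | h0
    · refine ⟨Set.Ico t u, ?_, {Set.Ico t u}, Set.finite_singleton _, by simp, ?_⟩
      · refine mem_nhdsWithin_of_mem_nhds (mem_of_superset (Iio_mem_nhds hu) ?_)
        intro s hs
        exact ⟨by rw [← h0]; exact zero_le, hs⟩
      · rintro c rfl
        exact ⟨Set.ordConnected_Ico, fun s hs s' hs' => hball (hRu hs) (hRu hs')⟩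
    · obtain ⟨v, hv, hLv⟩ := (mem_nhdsLT_iff_exists_Ioo_subset' h0).1 hL
      refine ⟨Set.Ioo v u, mem_nhdsWithin_of_mem_nhds (Ioo_mem_nhds hv hu),
        {Set.Ioo v t, Set.Ico t u}, by simp, ?_, ?_⟩
      · intro s hs
        rcases lt_or_ge s t with h | h
        · exact ⟨Set.Ioo v t, by simp, hs.1, h⟩
        · exact ⟨Set.Ico t u, by simp, h, hs.2⟩
      · rintro c (rfl | rfl)
        · exact ⟨Set.ordConnected_Ioo, fun s hs s' hs' => hball (hLv hs) (hLv hs')⟩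
        · exact ⟨Set.ordConnected_Ico, fun s hs s' hs' => hball (hRu hs) (hRu hs')⟩

theorem CadlagPath.isRationalCadlag (ω : CadlagPath E) :
    IsRationalCadlag (fun q : ℚ≥0 => ω q) := by
  refine ⟨fun N k => ?_, fun q k => ?_⟩
  · obtain ⟨C, hfin, hcov, hC⟩ := exists_oscillation_cover ω.2 N (ε := 1 / (k + 1)) (by positivity)
    have : Fintype C := hfin.fintype
    refine ⟨Fintype.card C, fun q hq hqN => ?_⟩
    have hpiece : ∀ i, ∃ c : C, (q i : ℝ≥0) ∈ c.1 := by
      intro i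
      obtain ⟨c, hc, h⟩ := hcov (show (q i : ℝ≥0) ∈ Set.Icc 0 (N : ℝ≥0) from
        ⟨zero_le, by exact_mod_cast hqN i⟩)
      exact ⟨⟨c, hc⟩, h⟩
    choose g hg using hpiece
    -- There are more times than pieces, so two times share a piece; being order-connected, it also
    -- contains the successor of the earlier time.
    have : ∃ i j, g i = g j ∧ i < j := by
      obtain ⟨i, j, hij, h⟩ := Fintype.exists_ne_map_eq_of_card_lt g (by simp)
      rcases lt_or_gt_of_ne hij with h' | h'
      exacts [⟨i, j, h, h'⟩, ⟨j, i, h.symm, h'⟩]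
    obtain ⟨i, j, hij, hlt⟩ := this
    have hi : i.1 < Fintype.card C := lt_of_lt_of_le hlt (Nat.lt_succ_iff.1 j.2)
    refine ⟨⟨i.1, hi⟩, ?_⟩
    have h1 : (⟨i.1, hi⟩ : Fin (Fintype.card C)).castSucc = i := rfl
    have h2 : (⟨i.1, hi⟩ : Fin (Fintype.card C)).succ ≤ j := hlt
    have h3 : i ≤ (⟨i.1, hi⟩ : Fin (Fintype.card C)).succ := Nat.le_succ _
    rw [h1]
    obtain ⟨hord, hosc⟩ := hC _ (g i).2
    refine hosc _ (hg i) _ (hord.out (hg i) (hij ▸ hg j) ⟨?_, ?_⟩)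
    · exact_mod_cast hq.monotone h3
    · exact_mod_cast hq.monotone h2
  · have h := (ω.tendsto_rationalsRight q).eventually
      (Metric.closedBall_mem_nhds _ (show (0 : ℝ) < 1 / (k + 1) by positivity))
    obtain ⟨u, hu, h⟩ := eventually_rationalsRight.1 h
    obtain ⟨j, hj⟩ := exists_nat_one_div_lt (tsub_pos_of_lt hu)
    refine ⟨j, fun r hr hrj => h r (by exact_mod_cast hr) ?_⟩
    have h2 : (r : ℝ≥0) < q + 1 / (j + 1) := by
      simpa using (NNRat.cast_lt (K := ℝ≥0)).2 hrj
    refine h2.trans ?_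
    rw [add_comm]
    exact lt_tsub_iff_right.1 hj

/-- Two values more than `2ε` apart cannot both lie within `ε` of a third one. -/
theorem exists_dist_lt_of_cauchy_fails {ι : Type*} {f : ι → E} {p : ι → Prop} {ε : ℝ}
    {s t r : ι} (hs : p s) (ht : p t) (h : 2 * ε < dist (f s) (f t)) :
    ∃ q, p q ∧ ε < dist (f r) (f q) := by
  by_contra! hcon
  have := dist_triangle_left (f s) (f t) (f r)
  linarith [hcon s hs, hcon t ht]

theorem IsRationalCadlag.cauchy_right {f : ℚ≥0 → E} (hf : IsRationalCadlag f) (t : ℝ≥0) :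
    Cauchy (map f (rationalsRight t)) := by
  rw [Metric.cauchy_iff]
  refine ⟨inferInstance, fun ε hε => ?_⟩
  by_contra hcon
  obtain ⟨k, hk⟩ := exists_nat_one_div_lt (show 0 < ε / 4 by positivity)
  obtain ⟨N, hN⟩ := exists_nat_gt (t + 1)
  obtain ⟨m, hm⟩ := hf.1 N k
  -- If the Cauchy property fails, every rational `r > t` admits a rational closer to `t` at which
  -- `f` has jumped by more than `1 / (k + 1)`. Iteration violates the bound on the number of
  -- oscillations.
  have hstep : ∀ r : {r : ℚ≥0 // t < r ∧ (r : ℝ≥0) ≤ N}, ∃ q : {r : ℚ≥0 // t < r ∧ (r : ℝ≥0) ≤ N},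
      q.1 < r.1 ∧ 1 / (k + 1 : ℝ) < dist (f r.1) (f q.1) := by
    intro r
    by_contra! h
    refine hcon ⟨f '' {q | t < q ∧ q < r.1}, ?_, ?_⟩
    · refine image_mem_map ?_
      exact eventually_rationalsRight.2 ⟨r.1, r.2.1, fun q h1 h2 => ⟨h1, by exact_mod_cast h2⟩⟩
    · rintro _ ⟨s, ⟨hs, hsr⟩, rfl⟩ _ ⟨u, ⟨hu, hur⟩, rfl⟩
      by_contra! h3
      obtain ⟨q, ⟨hq1, hq2⟩, hq⟩ := exists_dist_lt_of_cauchy_fails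
        (f := f) (p := fun q : ℚ≥0 => t < (q : ℝ≥0) ∧ q < r.1) (r := r.1) (ε := 1 / (k + 1))
        ⟨hs, hsr⟩ ⟨hu, hur⟩
        (by linarith)
      refine (h ⟨q, hq1, le_trans (by exact_mod_cast hq2.le) r.2.2⟩ hq2).not_gt hq
  choose g hg1 hg2 using hstep
  obtain ⟨r0, hr1, hr2⟩ := exists_nnrat_btwn (show t < t + 1 by simp)
  let p : ℕ → {r : ℚ≥0 // t < r ∧ (r : ℝ≥0) ≤ N} := fun n => g^[n] ⟨r0, hr1, (hr2.trans hN).le⟩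
  have hp : ∀ n, p (n + 1) = g (p n) := fun n => Function.iterate_succ_apply' g n _
  have hanti : StrictAnti (fun n => (p n).1) := strictAnti_nat_of_succ_lt fun n => by
    rw [hp]; exact hg1 _
  -- The times `p n` decrease to the right of `t`, so their order is reversed to fit the increasing
  -- chains of the definition.
  obtain ⟨i, hi⟩ := hm (fun i => (p (m - i)).1)
    (fun i j hij => hanti (by have := j.2; have : i.1 < j.1 := hij; omega))
    (fun i => by exact_mod_cast (p _).2.2)
  have hi' : m - (i.castSucc : Fin (m + 1)).1 = m - (i.succ : Fin (m + 1)).1 + 1 := by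
    simp; omega
  rw [hi', hp, dist_comm] at hi
  exact hi.not_gt (hg2 _)

theorem IsRationalCadlag.cauchy_left {f : ℚ≥0 → E} (hf : IsRationalCadlag f) {t : ℝ≥0}
    (ht : 0 < t) : Cauchy (map f (rationalsLeft t)) := by
  have := neBot_rationalsLeft ht
  rw [Metric.cauchy_iff]
  refine ⟨inferInstance, fun ε hε => ?_⟩
  by_contra hcon
  obtain ⟨k, hk⟩ := exists_nat_one_div_lt (show 0 < ε / 4 by positivity)
  obtain ⟨N, hN⟩ := exists_nat_gt t
  obtain ⟨m, hm⟩ := hf.1 N k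
  have hstep : ∀ r : {r : ℚ≥0 // (r : ℝ≥0) < t}, ∃ q : {r : ℚ≥0 // (r : ℝ≥0) < t},
      r.1 < q.1 ∧ 1 / (k + 1 : ℝ) < dist (f r.1) (f q.1) := by
    intro r
    by_contra! h
    refine hcon ⟨f '' {q | (q : ℝ≥0) < t ∧ r.1 < q}, ?_, ?_⟩
    · refine image_mem_map ?_
      exact (eventually_rationalsLeft ht).2 ⟨r.1, r.2, fun q h1 h2 => ⟨h2, by exact_mod_cast h1⟩⟩
    · rintro _ ⟨s, ⟨hs, hsr⟩, rfl⟩ _ ⟨u, ⟨hu, hur⟩, rfl⟩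
      by_contra! h3
      obtain ⟨q, ⟨hq1, hq2⟩, hq⟩ := exists_dist_lt_of_cauchy_fails
        (f := f) (p := fun q : ℚ≥0 => (q : ℝ≥0) < t ∧ r.1 < q) (r := r.1) (ε := 1 / (k + 1))
        ⟨hs, hsr⟩ ⟨hu, hur⟩ (by linarith)
      exact (h ⟨q, hq1⟩ hq2).not_gt hq
  choose g hg1 hg2 using hstep
  let p : ℕ → {r : ℚ≥0 // (r : ℝ≥0) < t} := fun n => g^[n] ⟨0, by simpa using ht⟩
  have hp : ∀ n, p (n + 1) = g (p n) := fun n => Function.iterate_succ_apply' g n _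
  have hmono : StrictMono (fun n => (p n).1) := strictMono_nat_of_lt_succ fun n => by
    rw [hp]; exact hg1 _
  obtain ⟨i, hi⟩ := hm (fun i => (p i).1) (fun i j hij => hmono hij)
    (fun i => by exact_mod_cast ((p _).2.trans hN).le)
  simp only [Fin.val_castSucc, Fin.val_succ, hp] at hi
  exact hi.not_gt (hg2 _)

/-- The trajectory is the right limit of `f` along the rationals. Limits transfer from `f` to this
extension through closed neighbourhoods, and the second clause of `IsRationalCadlag` makes it agree
with `f` at rational times. -/
theorem IsRationalCadlag.exists_path [CompleteSpace E] {f : ℚ≥0 → E} (hf : IsRationalCadlag f) :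
    ∃ ω : CadlagPath E, (fun q : ℚ≥0 => ω q) = f := by
  have hright : ∀ t : ℝ≥0, ∃ l, Tendsto f (rationalsRight t) (𝓝 l) := fun t =>
    cauchy_map_iff_exists_tendsto.1 (hf.cauchy_right t)
  choose g hg using hright
  have hclosed : ∀ {u v : ℝ≥0} {V : Set E}, IsClosed V →
      (∀ q : ℚ≥0, u < q → (q : ℝ≥0) < v → f q ∈ V) → ∀ s, u ≤ s → s < v → g s ∈ V := by
    intro u v V hV h s hus hsv
    refine hV.mem_of_tendsto (hg s) (eventually_rationalsRight.2 ⟨v, hsv, fun q h1 h2 => ?_⟩)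
    exact h q (hus.trans_lt h1) h2
  have hcadlag : IsCadlag g := by
    intro t
    constructor
    · rw [ContinuousWithinAt, (closed_nhds_basis (g t)).tendsto_right_iff]
      rintro V ⟨hV, hVc⟩
      obtain ⟨u, hu, h⟩ := eventually_rationalsRight.1 ((hg t).eventually hV)
      exact mem_of_superset (Ico_mem_nhdsGE hu) fun s hs => hclosed hVc h s hs.1 hs.2
    · rcases eq_or_lt_of_le (zero_le (a := t)) with h0 | h0
      · refine ⟨g t, ?_⟩
        have : Set.Iio t = ∅ := by rw [← h0]; ext; simp
        rw [this, nhdsWithin_empty]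
        exact tendsto_bot
      · have := neBot_rationalsLeft h0
        obtain ⟨l, hl⟩ := cauchy_map_iff_exists_tendsto.1 (hf.cauchy_left h0)
        refine ⟨l, ?_⟩
        rw [(closed_nhds_basis l).tendsto_right_iff]
        rintro V ⟨hV, hVc⟩
        obtain ⟨u, hu, h⟩ := (eventually_rationalsLeft h0).1 (hl.eventually hV)
        exact mem_of_superset (Ioo_mem_nhdsLT hu) fun s hs => hclosed hVc h s hs.1.le hs.2
  refine ⟨⟨g, hcadlag⟩, funext fun q => ?_⟩
  refine tendsto_nhds_unique (hg q) ?_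
  rw [Metric.nhds_basis_closedBall.tendsto_right_iff]
  intro ε hε
  obtain ⟨k, hk⟩ := exists_nat_one_div_lt hε
  obtain ⟨j, hj⟩ := hf.2 q k
  refine eventually_rationalsRight.2 ⟨q + 1 / (j + 1), ?_, fun r h1 h2 => ?_⟩
  · exact lt_add_of_pos_right _ (by positivity)
  · exact (hj r (by exact_mod_cast h1)
      ((NNRat.cast_lt (K := ℝ≥0)).1 (by simpa using h2))).trans hk.le

/-- Every quantifier in the definition ranges over a countable set, including the one over finite
chains of rationals. -/
theorem measurableSet_isRationalCadlag [MeasurableSpace E] [BorelSpace E]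
    [SecondCountableTopology E] : MeasurableSet {f : ℚ≥0 → E | IsRationalCadlag f} := by
  have hd : ∀ (a b : ℚ≥0) (k : ℕ), MeasurableSet {f : ℚ≥0 → E | dist (f a) (f b) ≤ 1 / (k + 1)} :=
    fun a b k => measurableSet_le ((measurable_pi_apply a).dist (measurable_pi_apply b))
      measurable_const
  have : {f : ℚ≥0 → E | IsRationalCadlag f} =
      (⋂ (N : ℕ) (k : ℕ), ⋃ m : ℕ, ⋂ (q : Fin (m + 1) → ℚ≥0) (_ : StrictMono q)
        (_ : ∀ i, q i ≤ N), ⋃ i : Fin m,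
          {f | dist (f (q i.castSucc)) (f (q i.succ)) ≤ 1 / (k + 1)}) ∩
      ⋂ (q : ℚ≥0) (k : ℕ), ⋃ j : ℕ, ⋂ (r : ℚ≥0) (_ : q < r) (_ : r < q + 1 / (j + 1)),
        {f | dist (f r) (f q) ≤ 1 / (k + 1)} := by
    ext f
    simp [IsRationalCadlag]
  rw [this]
  refine MeasurableSet.inter ?_ ?_
  · exact .iInter fun N => .iInter fun k => .iUnion fun m => .iInter fun q => .iInter fun _ =>
      .iInter fun _ => .iUnion fun i => hd _ _ _
  · exact .iInter fun q => .iInter fun k => .iUnion fun j => .iInter fun r => .iInter fun _ =>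
      .iInter fun _ => hd _ _ _

/-- Right-continuity recovers the value at each time as a limit along rationals, which gives both
injectivity and equality of the σ-algebras. The range is measurable by the oscillation criterion. -/
theorem measurableEmbedding_restrict_rational [CompleteSpace E] [MeasurableSpace E] [BorelSpace E]
    [SecondCountableTopology E] :
    MeasurableEmbedding (fun (ω : CadlagPath E) (q : ℚ≥0) => ω q) := by
  have hmeas : Measurable (fun (ω : CadlagPath E) (q : ℚ≥0) => ω q) :=
    measurable_pi_iff.2 fun q => measurable_coord (q : ℝ≥0)
  refine ⟨fun ω ω' h => ?_, hmeas, ?_⟩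
  · ext t
    refine tendsto_nhds_unique (ω.tendsto_rationalsRight t) ?_
    have : (fun q : ℚ≥0 => ω q) = fun q : ℚ≥0 => ω' q := h
    rw [this]
    exact ω'.tendsto_rationalsRight t
  · have hrange : MeasurableSet (Set.range (fun (ω : CadlagPath E) (q : ℚ≥0) => ω q)) := by
      convert measurableSet_isRationalCadlag (E := E) using 1
      ext f
      exact ⟨by rintro ⟨ω, rfl⟩; exact ω.isRationalCadlag, fun hf => hf.exists_path⟩
    have hcomap : (inferInstance : MeasurableSpace (CadlagPath E)) ≤
        MeasurableSpace.comap (fun (ω : CadlagPath E) (q : ℚ≥0) => ω q) inferInstance := by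
      refine le_of_measurable_coord fun t => ?_
      have : ∃ u : ℕ → ℚ≥0, Tendsto u atTop (rationalsRight t) := by
        have : (rationalsRight t).IsCountablyGenerated := by
          unfold rationalsRight; infer_instance
        exact exists_seq_tendsto _
      obtain ⟨u, hu⟩ := this
      refine @measurable_of_tendsto_metrizable _ _ (_) _ _ _ _ (fun n (ω : CadlagPath E) => ω (u n))
        _ (fun n => ?_) ?_
      · exact (measurable_pi_apply (u n)).comp
          (comap_measurable (fun (ω : CadlagPath E) (q : ℚ≥0) => ω q))
      · rw [tendsto_pi_nhds]
        exact fun ω => (ω.tendsto_rationalsRight t).comp hu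
    intro s hs
    obtain ⟨B, hB, rfl⟩ := hcomap s hs
    rw [Set.image_preimage_eq_inter_range]
    exact hB.inter hrange

/-- A Polish topology on the measurable range is pulled back along the bijection. -/
theorem _root_.MeasurableEmbedding.standardBorelSpace {α β : Type*} [MeasurableSpace α]
    [MeasurableSpace β] [StandardBorelSpace β] {f : α → β} (hf : MeasurableEmbedding f) :
    StandardBorelSpace α := by
  have : StandardBorelSpace (Set.range f) := hf.measurableSet_range.standardBorel
  let := upgradeStandardBorel (Set.range f)
  let e := hf.equivRange
  let : TopologicalSpace α := .induced e inferInstance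
  refine ⟨inferInstance, ⟨?_⟩, e.toEquiv.polishSpace_induced⟩
  rw [borel_comap, ← BorelSpace.measurable_eq]
  exact e.measurableEmbedding.comap_eq.symm

end StandardBorel

instance standardBorelSpace_cadlagPath {E : Type*} [TopologicalSpace E] [PolishSpace E]
    [MeasurableSpace E] [BorelSpace E] : StandardBorelSpace (CadlagPath E) := by
  let := TopologicalSpace.upgradeIsCompletelyMetrizable E
  exact measurableEmbedding_restrict_rational.standardBorelSpace

/-- A locally compact, second countable metric space is Polish. -/
theorem polishSpace_of_locallyCompactSpace (E : Type*) [MetricSpace E] [LocallyCompactSpace E]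
    [SecondCountableTopology E] : PolishSpace E := by
  let e : E → UniformSpace.Completion E := fun x => x
  have hd : IsDenseEmbedding e := UniformSpace.Completion.isDenseEmbedding_coe
  have : TopologicalSpace.SeparableSpace (UniformSpace.Completion E) :=
    hd.isDenseInducing.separableSpace
  have : SecondCountableTopology (UniformSpace.Completion E) :=
    UniformSpace.secondCountable_of_separable _
  have hopen : IsOpen (Set.range e) := by
    rw [isOpen_iff_mem_nhds]
    rintro _ ⟨x, rfl⟩
    obtain ⟨C, hC, hCx⟩ := exists_compact_mem_nhds x
    have hCimg : IsClosed (e '' C) := (hC.image hd.continuous).isClosed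
    rw [hd.isInducing.nhds_eq_comap, mem_comap] at hCx
    obtain ⟨V, hV, hVC⟩ := hCx
    obtain ⟨U, hUV, hU, hxU⟩ := mem_nhds_iff.1 hV
    refine mem_of_superset (hU.mem_nhds hxU) ?_
    -- Points of the completion near `x` are limits of points of a compact neighbourhood of `x`,
    -- whose image is already closed; so they lie in `E`.
    have h1 : U ⊆ closure (U ∩ Set.range e) := hd.dense.open_subset_closure_inter hU
    have h2 : U ∩ Set.range e ⊆ e '' C := by
      rintro _ ⟨hy, y, rfl⟩
      exact ⟨y, hVC (hUV hy), rfl⟩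
    exact (h1.trans (closure_minimal h2 hCimg)).trans (Set.image_subset_range _ _)
  have := hopen.polishSpace
  exact (hd.isEmbedding.toHomeomorph.symm.symm).isClosedEmbedding.polishSpace

/-! ### Universal measurability of analytic sets. -/

section Analytic

/-- The bounds `n 0, n 1, …` are chosen one at a time: continuity from below, valid for the outer
measure of arbitrary sets, allows each new coordinate to be bounded while the measure stays above
`c`. -/
theorem exists_bounds_of_lt_measure_range {α : Type*} [MeasurableSpace α] {f : (ℕ → ℕ) → α}
    (μ : Measure α)
    {c : ℝ≥0∞} (hc : c < μ (Set.range f)) :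
    ∃ n : ℕ → ℕ, ∀ k, c < μ (f '' {x | ∀ i < k, x i ≤ n i}) := by
  have hstep : ∀ (k : ℕ) (A : {A : Set (ℕ → ℕ) // c < μ (f '' A)}), ∃ m : ℕ,
      c < μ (f '' (A.1 ∩ {x | x k ≤ m})) := by
    rintro k ⟨A, hA⟩
    have hU : f '' A = ⋃ m : ℕ, f '' (A ∩ {x | x k ≤ m}) := by
      rw [← Set.image_iUnion, ← Set.inter_iUnion]
      congr 1
      refine (Set.inter_eq_left.2 fun x _ => ?_).symm
      exact Set.mem_iUnion.2 ⟨x k, le_refl (x k)⟩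
    have hmono : Monotone (fun m : ℕ => f '' (A ∩ {x | x k ≤ m})) := fun m m' h =>
      Set.image_mono (Set.inter_subset_inter_right _ fun x (hx : x k ≤ m) => hx.trans h)
    rw [hU, hmono.measure_iUnion] at hA
    exact lt_iSup_iff.1 hA
  choose g hg using hstep
  let A : ℕ → {A : Set (ℕ → ℕ) // c < μ (f '' A)} := fun k =>
    Nat.rec ⟨Set.univ, by rwa [Set.image_univ]⟩ (fun k A => ⟨_, hg k A⟩) k
  refine ⟨fun k => g k (A k), fun k => ?_⟩
  convert (A k).2 using 3
  induction k with
  | zero => simp [A]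
  | succ k ih =>
    have : (A (k + 1)).1 = (A k).1 ∩ {x | x k ≤ g k (A k)} := rfl
    rw [this, ← ih]
    ext x
    exact Nat.forall_lt_succ_right

variable {α : Type*} [TopologicalSpace α]

theorem isCompact_setOf_forall_le (n : ℕ → ℕ) : IsCompact {y : ℕ → ℕ | ∀ i, y i ≤ n i} := by
  have : {y : ℕ → ℕ | ∀ i, y i ≤ n i} = Set.univ.pi fun i => Set.Iic (n i) := by
    ext
    simp [Pi.le_def]
  rw [this]
  exact isCompact_univ_pi fun i => (Set.finite_Iic (n i)).isCompact

/-- Otherwise there are points `x k` obeying the first `k` bounds with image outside `U`. Truncating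
them puts them into a compact box, and a limit point in the box contradicts openness. -/
theorem exists_image_subset_of_isOpen {f : (ℕ → ℕ) → α} (hf : Continuous f) (n : ℕ → ℕ)
    {U : Set α} (hU : IsOpen U) (h : f '' {x | ∀ i, x i ≤ n i} ⊆ U) :
    ∃ k, f '' {x | ∀ i < k, x i ≤ n i} ⊆ U := by
  by_contra! hcon
  have : ∀ k, ∃ x : ℕ → ℕ, (∀ i < k, x i ≤ n i) ∧ f x ∉ U := by
    intro k
    obtain ⟨_, ⟨x, hx, rfl⟩, hxU⟩ := Set.not_subset.1 (hcon k)
    exact ⟨x, hx, hxU⟩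
  choose x hx hxU using this
  obtain ⟨y, hy, φ, hφ, hlim⟩ := (isCompact_setOf_forall_le n).tendsto_subseq
    (x := fun k i => min (x k i) (n i))
    (fun k i => min_le_right _ _)
  have hlim' : Tendsto (fun k => x (φ k)) atTop (𝓝 y) := by
    rw [tendsto_pi_nhds] at hlim ⊢
    intro i
    refine (hlim i).congr' ?_
    filter_upwards [eventually_gt_atTop i] with k hk
    exact min_eq_left (hx _ i (hk.trans_le hφ.le_apply))
  have hmem : f y ∈ U := h ⟨y, hy, rfl⟩
  obtain ⟨k, hk⟩ := (((hf.tendsto y).comp hlim').eventually (hU.mem_nhds hmem)).exists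
  exact hxU _ hk

/-- Analytic sets are universally measurable. -/
theorem nullMeasurableSet_of_analyticSet [T2Space α] [MeasurableSpace α] [BorelSpace α]
    {s : Set α} (hs : AnalyticSet s) (μ : Measure α) [IsFiniteMeasure μ] [μ.OuterRegular] :
    NullMeasurableSet s μ := by
  rw [AnalyticSet] at hs
  rcases hs with rfl | ⟨f, hf, rfl⟩
  · exact MeasurableSet.empty.nullMeasurableSet
  have key : ∀ c < μ (Set.range f), ∃ M ⊆ Set.range f, MeasurableSet M ∧ c ≤ μ M := by
    intro c hc
    obtain ⟨n, hn⟩ := exists_bounds_of_lt_measure_range μ hc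
    refine ⟨f '' {y | ∀ i, y i ≤ n i}, Set.image_subset_range _ _,
      ((isCompact_setOf_forall_le n).image hf).isClosed.measurableSet, ?_⟩
    -- The compact image need not inherit the bound by continuity from above, since the larger
    -- images may be non-measurable. Each open superset contains one of them, so outer regularity
    -- suffices.
    rw [Set.measure_eq_iInf_isOpen]
    refine le_iInf₂ fun U hU => le_iInf fun hUo => ?_
    obtain ⟨k, hk⟩ := exists_image_subset_of_isOpen hf n hUo hU
    exact (hn k).le.trans (measure_mono hk)
  rcases eq_or_ne (μ (Set.range f)) 0 with h0 | h0
  · exact NullMeasurableSet.of_null h0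
  obtain ⟨c, -, hc, hlim⟩ := exists_seq_strictMono_tendsto' (pos_iff_ne_zero.2 h0)
  choose M hMs hM hcM using fun j => key (c j) (hc j).2
  have hsub : (⋃ j, M j) ⊆ Set.range f := Set.iUnion_subset hMs
  have hle : μ (Set.range f) ≤ μ (⋃ j, M j) :=
    le_of_tendsto' hlim fun j => (hcM j).trans (measure_mono (Set.subset_iUnion _ _))
  refine NullMeasurableSet.congr (MeasurableSet.iUnion hM).nullMeasurableSet ?_
  refine ae_eq_of_subset_of_measure_ge hsub hle (MeasurableSet.iUnion hM).nullMeasurableSet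
    (measure_ne_top _ _)

end Analytic

theorem nullMeasurableSet_image_of_standardBorel {α β : Type*} [MeasurableSpace α]
    [StandardBorelSpace α] [MeasurableSpace β] [StandardBorelSpace β] {s : Set α}
    (hs : MeasurableSet s) {f : α → β} (hf : Measurable f) (μ : Measure β) [IsFiniteMeasure μ] :
    NullMeasurableSet (f '' s) μ := by
  let := upgradeStandardBorel β
  exact nullMeasurableSet_of_analyticSet (hs.analyticSet_image hf) μ

/-! ### The hitting time of a closed set is a stopping time. -/

section HitTime

variable {E : Type*} [TopologicalSpace E]

/-- The infimum is approached by hitting times from the right, so right-continuity and closedness of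
`K` show that it is attained. -/
theorem exists_mem_of_hitTime_eq {K : Set E} (hK : IsClosed K) {ω : CadlagPath E} {t : ℝ≥0}
    (h : hitTime K ω = t) : ω t ∈ K := by
  classical
  rw [hitTime, hittingAfter] at h
  split_ifs at h with hex
  · have hs : sInf {i : ℝ≥0 | 0 ≤ i ∧ ω i ∈ K} = t := by exact_mod_cast h
    have hne : {i : ℝ≥0 | 0 ≤ i ∧ ω i ∈ K}.Nonempty := hex
    rw [← hs]
    set r := sInf {i : ℝ≥0 | 0 ≤ i ∧ ω i ∈ K}
    have hcl : r ∈ closure {i : ℝ≥0 | 0 ≤ i ∧ ω i ∈ K} :=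
      csInf_mem_closure hne (OrderBot.bddBelow _)
    have : (𝓝[{i : ℝ≥0 | 0 ≤ i ∧ ω i ∈ K}] r).NeBot := mem_closure_iff_nhdsWithin_neBot.1 hcl
    have hsub : {i : ℝ≥0 | 0 ≤ i ∧ ω i ∈ K} ⊆ Set.Ici r := fun i hi =>
      csInf_le (OrderBot.bddBelow _) hi
    refine hK.mem_of_tendsto ((ω.2 r).1.tendsto.mono_left (nhdsWithin_mono _ hsub)) ?_
    filter_upwards [self_mem_nhdsWithin] with i hi using hi.2
  · exact absurd h.symm WithTop.coe_ne_top

theorem hitTime_le_iff {K : Set E} (hK : IsClosed K) {ω : CadlagPath E} {t : ℝ≥0} :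
    hitTime K ω ≤ t ↔ ∃ s ≤ t, ω s ∈ K := by
  constructor
  · intro h
    lift hitTime K ω to ℝ≥0 using ne_top_of_le_ne_top WithTop.coe_ne_top h with s hs
    exact ⟨s, by exact_mod_cast h, exists_mem_of_hitTime_eq hK hs.symm⟩
  · rintro ⟨s, hst, hs⟩
    refine (hittingAfter_le_of_mem (u := fun t (ω : CadlagPath E) => ω t) zero_le hs).trans ?_
    exact_mod_cast hst

variable [PolishSpace E] [MeasurableSpace E] [BorelSpace E]

/-- The event is the projection of a Borel subset of time × path space, hence analytic. -/
theorem nullMeasurableSet_hitTime_le {K : Set E} (hK : IsClosed K) (t : ℝ≥0)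
    (P : Measure (CadlagPath E)) [IsFiniteMeasure P] :
    NullMeasurableSet {ω | hitTime K ω ≤ t} P := by
  have : {ω : CadlagPath E | hitTime K ω ≤ t} =
      Prod.snd '' {p : ℝ≥0 × CadlagPath E | p.1 ≤ t ∧ p.2 p.1 ∈ K} := by
    ext ω
    refine (hitTime_le_iff hK).trans ⟨?_, ?_⟩
    · rintro ⟨s, hs, h⟩
      exact ⟨(s, ω), ⟨hs, h⟩, rfl⟩
    · rintro ⟨⟨s, ω'⟩, ⟨hs, h⟩, rfl⟩
      exact ⟨s, hs, h⟩
  rw [this]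
  exact nullMeasurableSet_image_of_standardBorel
    ((measurableSet_le measurable_fst measurable_const).inter (measurable_eval hK.measurableSet))
    measurable_snd P

/-- Whether `K` is hit by time `t` depends only on the trajectory stopped at `t`. A Borel
approximation of the event under the law of the stopped path therefore pulls back to an
approximation in the past σ-algebra. -/
theorem isStoppingTime_hitTime {K : Set E} (hK : IsClosed K)
    (P : Measure (CadlagPath E)) [IsFiniteMeasure P] :
    IsStoppingTime (completedFiltration P) (hitTime K) := by
  intro t
  obtain ⟨B, hB, hAB⟩ := nullMeasurableSet_hitTime_le hK t (P.map (CadlagPath.stopAt t))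
  refine ⟨CadlagPath.stopAt t ⁻¹' B, measurable_stopAt_pastSigma t hB, ?_⟩
  have h1 := ae_of_ae_map (measurable_stopAt t).aemeasurable hAB
  have h2 : {ω : CadlagPath E | hitTime K ω ≤ t} =
      CadlagPath.stopAt t ⁻¹' {ω : CadlagPath E | hitTime K ω ≤ t} := by
    ext ω
    simp only [Set.mem_preimage, Set.mem_ofPred_eq, hitTime_le_iff hK, CadlagPath.stopAt_apply]
    constructor
    · rintro ⟨s, hs, h⟩
      exact ⟨s, hs, by rwa [min_eq_left hs]⟩
    · rintro ⟨s, hs, h⟩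
      exact ⟨s, hs, by rwa [min_eq_left hs] at h⟩
  rw [h2]
  exact h1

end HitTime

/-! ### Markov property and the Lyapunov bound. -/

namespace StrongMarkovProcess

section Markov

variable {E : Type*} [TopologicalSpace E] [MeasurableSpace E] (X : StrongMarkovProcess E)

theorem transition_apply (t : ℝ≥0) (x : E) :
    X.transition t x = (X.law x).map (fun ω => ω t) :=
  Kernel.map_apply _ (measurable_coord t) _

theorem lintegral_transition (t : ℝ≥0) (x : E) {g : E → ℝ≥0∞} (hg : Measurable g) :
    ∫⁻ y, g y ∂(X.transition t x) = ∫⁻ ω, g (ω t) ∂(X.law x) := by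
  rw [transition_apply, lintegral_map hg (measurable_coord t)]

/-- The Markov property at a fixed time. -/
theorem measure_inter_shift (x : E) (s : ℝ≥0) {A : Set (CadlagPath E)}
    (hA : MeasurableSet[pastSigma s] A) {B : Set (CadlagPath E)} (hB : MeasurableSet B) :
    X.law x (A ∩ CadlagPath.shift s ⁻¹' B) = ∫⁻ ω in A, X.law (ω s) B ∂(X.law x) := by
  have hτ := isStoppingTime_const (completedFiltration (X.law x)) s
  have hA' : MeasurableSet[hτ.measurableSpace] A := by
    rw [IsStoppingTime.measurableSpace_const]
    exact ⟨A, hA, ae_eq_refl _⟩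
  have h := X.strongMarkov x _ hτ A hA' B hB
  have hs : {_ω : CadlagPath E | (s : WithTop ℝ≥0) < ⊤} = Set.univ :=
    Set.eq_univ_of_forall fun _ => WithTop.coe_lt_top s
  rw [hs, Set.inter_univ] at h
  exact h

/-- The law of the pair (past, future) at a fixed time. -/
theorem map_stopAt_shift (x : E) (s : ℝ≥0) :
    (X.law x).map (fun ω => (CadlagPath.stopAt s ω, CadlagPath.shift s ω)) =
      ((X.law x) ⊗ₘ X.law.comap (fun ω : CadlagPath E => ω s) (measurable_coord s)).map
        (Prod.map (CadlagPath.stopAt s) id) := by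
  have h1 : Measurable (fun ω : CadlagPath E => (CadlagPath.stopAt s ω, CadlagPath.shift s ω)) :=
    (measurable_stopAt s).prodMk (measurable_shift s)
  have := Measure.isProbabilityMeasure_map h1.aemeasurable (μ := X.law x)
  refine Measure.ext_prod fun {A B} hA hB => ?_
  rw [Measure.map_apply h1 (hA.prod hB),
    Measure.map_apply ((measurable_stopAt s).prodMap measurable_id) (hA.prod hB)]
  have : Prod.map (CadlagPath.stopAt s) id ⁻¹' (A ×ˢ B) = (CadlagPath.stopAt s ⁻¹' A) ×ˢ B := rfl
  rw [this, Measure.compProd_apply_prod (measurable_stopAt s hA) hB]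
  exact X.measure_inter_shift x s (measurable_stopAt_pastSigma s hA) hB

/-- Restarting the process at a fixed time from its current position does not change its law. -/
theorem map_glue (x : E) (s : ℝ≥0) :
    ((X.law x) ⊗ₘ X.law.comap (fun ω : CadlagPath E => ω s) (measurable_coord s)).map
      (fun p => CadlagPath.glue s p.1 p.2) = X.law x := by
  have h1 : Measurable (fun ω : CadlagPath E => (CadlagPath.stopAt s ω, CadlagPath.shift s ω)) :=
    (measurable_stopAt s).prodMk (measurable_shift s)
  have h := congrArg (Measure.map (fun p => CadlagPath.glue s p.1 p.2)) (X.map_stopAt_shift x s)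
  rw [Measure.map_map (measurable_glue s) h1, Measure.map_map (measurable_glue s)
    ((measurable_stopAt s).prodMap measurable_id)] at h
  have e1 : (fun p : CadlagPath E × CadlagPath E => CadlagPath.glue s p.1 p.2) ∘
      (fun ω => (CadlagPath.stopAt s ω, CadlagPath.shift s ω)) = id :=
    funext fun ω => CadlagPath.glue_stopAt_shift s ω
  have e2 : (fun p : CadlagPath E × CadlagPath E => CadlagPath.glue s p.1 p.2) ∘
      Prod.map (CadlagPath.stopAt s) id = fun p => CadlagPath.glue s p.1 p.2 :=
    funext fun p => CadlagPath.glue_stopAt s p.1 p.2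
  rw [e1, e2, Measure.map_id] at h
  exact h.symm

theorem map_shift (x : E) (s : ℝ≥0) :
    (X.law x).map (CadlagPath.shift s) = (X.transition s x).bind X.law := by
  ext B hB
  rw [Measure.map_apply (measurable_shift s) hB, Measure.bind_apply hB X.law.aemeasurable,
    lintegral_transition _ _ _ (X.law.measurable_coe hB)]
  simpa using X.measure_inter_shift x s MeasurableSet.univ hB

theorem transition_add (x : E) (s t : ℝ≥0) :
    X.transition (s + t) x = (X.transition s x).bind (X.transition t) := by
  ext A hA
  have h := DFunLike.congr_fun (X.map_shift x s) ((fun ω : CadlagPath E => ω t) ⁻¹' A)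
  rw [Measure.map_apply (measurable_shift s) (measurable_coord t hA),
    Measure.bind_apply (measurable_coord t hA) X.law.aemeasurable] at h
  rw [X.transition_apply (s + t), Measure.map_apply (measurable_coord _) hA,
    Measure.bind_apply hA (X.transition t).aemeasurable]
  refine Eq.trans h (lintegral_congr fun y => ?_)
  rw [transition_apply, Measure.map_apply (measurable_coord _) hA]

end Markov

section Lyapunov

variable {E : Type*} [TopologicalSpace E] [PolishSpace E] [MeasurableSpace E] [BorelSpace E]
  (X : StrongMarkovProcess E)

/-- After hitting `K` the expectation of `g` is bounded by its supremum over starting points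
in `K`. -/
theorem setLIntegral_hitTime_le {K : Set E} (hK : IsClosed K) {g : E → ℝ≥0∞} (hg : Measurable g)
    {M : ℝ≥0∞} (hM : ∀ y ∈ K, ∀ s : ℝ≥0, ∫⁻ ω, g (ω s) ∂(X.law y) ≤ M) (x : E) (t : ℝ≥0) :
    ∫⁻ ω in {ω | hitTime K ω ≤ t}, g (ω t) ∂(X.law x) ≤ M := by
  set P := X.law x
  set D : Set (CadlagPath E) := {ω | hitTime K ω ≤ t}
  have hD : NullMeasurableSet D P := nullMeasurableSet_hitTime_le hK t P
  have hτ := isStoppingTime_hitTime hK P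
  let τ₀ : CadlagPath E → ℝ≥0 := fun ω => (hitTime K ω).untopD 0
  have hcoe : ∀ ω ∈ D, hitTime K ω = τ₀ ω := by
    intro ω hω
    have hne : hitTime K ω ≠ ⊤ := ne_top_of_le_ne_top WithTop.coe_ne_top hω
    lift hitTime K ω to ℝ≥0 using hne with s hs
    simp only [τ₀, ← hs]
    rfl
  have hle : ∀ ω ∈ D, τ₀ ω ≤ t := by
    intro ω hω
    have := hcoe ω hω ▸ (show hitTime K ω ≤ t from hω)
    exact_mod_cast this
  have hmem : ∀ ω ∈ D, ω (τ₀ ω) ∈ K := fun ω hω => exists_mem_of_hitTime_eq hK (hcoe ω hω)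
  have hτ₀ : Measurable[hτ.measurableSpace] τ₀ :=
    (WithTop.measurable_untopD 0).comp hτ.measurable
  have hτ₀' : AEMeasurable τ₀ P := by
    refine NullMeasurable.aemeasurable fun I hI => ?_
    exact hτ.measurableSpace_le _ (hτ₀ hI)
  -- The hitting time is measurable only for the completed σ-algebra; a Borel version is needed to
  -- build kernels and product measures.
  let τ := hτ₀'.mk τ₀
  have hτm : Measurable τ := hτ₀'.measurable_mk
  have hττ₀ : τ₀ =ᵐ[P] τ := hτ₀'.ae_eq_mk
  have hXτ : Measurable (fun ω : CadlagPath E => ω (τ ω)) :=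
    measurable_eval.comp (hτm.prodMk measurable_id)
  have hshift : Measurable (fun ω : CadlagPath E => (τ ω, ω.shift (τ ω))) :=
    hτm.prodMk (measurable_shift_uncurry.comp (hτm.prodMk measurable_id))
  have hpair : Measurable (fun p : CadlagPath E × CadlagPath E => (τ p.1, p.2)) :=
    (hτm.comp measurable_fst).prodMk measurable_snd
  -- The strong Markov property, tested on the events `{τ₀ ∈ I} ∩ D` prior to `τ`, gives the joint
  -- law of `τ` and the shifted path. Keeping `τ` in the pair lets the random remaining time `t - τ`
  -- be frozen under the conditional law.
  have hlaw : (P.restrict D).map (fun ω => (τ ω, ω.shift (τ ω))) =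
      ((P.restrict D) ⊗ₘ X.law.comap (fun ω : CadlagPath E => ω (τ ω)) hXτ).map
        (fun p => (τ p.1, p.2)) := by
    refine Measure.ext_prod fun {I B} hI hB => ?_
    rw [Measure.map_apply hshift (hI.prod hB), Measure.map_apply hpair (hI.prod hB)]
    have e1 : (fun p : CadlagPath E × CadlagPath E => (τ p.1, p.2)) ⁻¹' (I ×ˢ B) =
      (τ ⁻¹' I) ×ˢ B := rfl
    rw [e1, Measure.compProd_apply_prod (hτm hI) hB, Measure.restrict_apply (hshift (hI.prod hB)),
      Measure.restrict_restrict (hτm hI)]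
    have hA : MeasurableSet[hτ.measurableSpace] (τ₀ ⁻¹' I ∩ D) :=
      (hτ₀ hI).inter (hτ.measurableSet_le' t)
    have hSM := X.strongMarkov x _ hτ _ hA B hB
    have e2 : τ₀ ⁻¹' I ∩ D ∩ {ω | hitTime K ω < ⊤} = τ₀ ⁻¹' I ∩ D :=
      Set.inter_eq_left.2 fun ω hω => lt_of_le_of_lt hω.2 (WithTop.coe_lt_top t)
    rw [e2] at hSM
    have e3 : (τ ⁻¹' I ∩ D : Set _) =ᵐ[P] (τ₀ ⁻¹' I ∩ D : Set _) := by
      filter_upwards [hττ₀] with ω hω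
      refine propext ?_
      change (τ ω ∈ I ∧ ω ∈ D) ↔ (τ₀ ω ∈ I ∧ ω ∈ D)
      rw [hω]
    have e4 : ((fun ω => (τ ω, ω.shift (τ ω))) ⁻¹' (I ×ˢ B) ∩ D : Set _) =ᵐ[P]
        (τ₀ ⁻¹' I ∩ D ∩ {ω | ω.shift (τ₀ ω) ∈ B} : Set _) := by
      filter_upwards [hττ₀] with ω hω
      refine propext ?_
      change ((τ ω ∈ I ∧ ω.shift (τ ω) ∈ B) ∧ ω ∈ D) ↔
        ((τ₀ ω ∈ I ∧ ω ∈ D) ∧ ω.shift (τ₀ ω) ∈ B)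
      rw [hω]
      tauto
    rw [measure_congr e4, Measure.restrict_congr_set e3]
    refine hSM.trans (lintegral_congr_ae (ae_restrict_of_ae ?_))
    filter_upwards [hττ₀] with ω hω
    rw [Kernel.comap_apply, ← hω]
  have hG : Measurable (fun p : ℝ≥0 × CadlagPath E => g (p.2 (t - p.1))) :=
    hg.comp (measurable_eval.comp ((measurable_const.sub measurable_fst).prodMk measurable_snd))
  have hmemD : ∀ᵐ ω ∂(P.restrict D), ω ∈ D := ae_restrict_mem₀ hD
  calc ∫⁻ ω in D, g (ω t) ∂P
      = ∫⁻ ω in D, g (ω.shift (τ ω) (t - τ ω)) ∂P := by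
        refine lintegral_congr_ae ?_
        filter_upwards [hmemD, ae_restrict_of_ae hττ₀] with ω hω hω'
        change g (ω t) = g (ω (τ ω + (t - τ ω)))
        rw [add_tsub_cancel_of_le (hω' ▸ hle ω hω)]
    _ = ∫⁻ p, g (p.2 (t - p.1)) ∂((P.restrict D).map (fun ω => (τ ω, ω.shift (τ ω)))) :=
        (lintegral_map hG hshift).symm
    _ = ∫⁻ ω in D, ∫⁻ ω', g (ω' (t - τ ω)) ∂(X.law (ω (τ ω))) ∂P := by
        rw [hlaw, lintegral_map hG hpair]
        exact Measure.lintegral_compProd (hG.comp hpair)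
    _ ≤ ∫⁻ _ in D, M ∂P := by
        refine lintegral_mono_ae ?_
        filter_upwards [hmemD, ae_restrict_of_ae hττ₀] with ω hω hω'
        exact hM _ (hω' ▸ hmem ω hω) _
    _ ≤ M := by
        rw [lintegral_const]
        refine mul_le_of_le_one_right' ?_
        rw [Measure.restrict_apply_univ]
        exact prob_le_one

/-- The mean of `g` is split according to whether `K` has been hit by time `t`; the two pieces are
bounded by `a` and `M`. -/
theorem lintegral_transition_le {K : Set E} (hK : IsClosed K) {g : E → ℝ≥0∞} (hg : Measurable g)
    {M a : ℝ≥0∞} (hM : ∀ y ∈ K, ∀ s : ℝ≥0, ∫⁻ ω, g (ω s) ∂(X.law y) ≤ M) (x : E) (t : ℝ≥0)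
    (ha : ∫⁻ ω, {ω | (t : WithTop ℝ≥0) < hitTime K ω}.indicator
      (fun ω => g (ω t)) ω ∂(X.law x) ≤ a) :
    ∫⁻ y, g y ∂(X.transition t x) ≤ a + M := by
  have hD := nullMeasurableSet_hitTime_le hK t (X.law x)
  have hc : {ω : CadlagPath E | (t : WithTop ℝ≥0) < hitTime K ω} = {ω | hitTime K ω ≤ t}ᶜ := by
    ext ω
    exact (not_le (a := hitTime K ω) (b := (t : WithTop ℝ≥0))).symm
  rw [hc, lintegral_indicator₀ hD.compl] at ha
  rw [lintegral_transition _ _ _ hg, ← setLIntegral_univ,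
    ← Set.compl_union_self {ω | hitTime K ω ≤ t}]
  exact (lintegral_union_le _ _ _).trans (add_le_add ha (X.setLIntegral_hitTime_le hK hg hM x t))

end Lyapunov

end StrongMarkovProcess

/-! ### Total variation and maximal coupling. -/

section TotalVariation

variable {S : Type*} [MeasurableSpace S]

/-- Since both measures have mass one, the positive and negative Jordan parts have equal mass, so
half the norm is the mass of the positive part. -/
theorem measure_le_add_of_varDist [TopologicalSpace S] {μ ν : Measure S} [IsProbabilityMeasure μ]
    [IsProbabilityMeasure ν] {B : Set S} (hB : MeasurableSet B) :
    μ B ≤ ν B + StrongMarkovProcess.varDist μ ν / 2 := by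
  set s := μ.toSignedMeasure - ν.toSignedMeasure with hs
  set J := s.toJordanDecomposition with hJ
  have hsJ : ∀ A, MeasurableSet A → μ.real A - ν.real A =
      J.posPart.real A - J.negPart.real A := by
    intro A hA
    have h := congrArg (fun v : SignedMeasure S => v A) s.toSignedMeasure_toJordanDecomposition
    rw [← hJ, JordanDecomposition.toSignedMeasure] at h
    simpa [hs, hA, Measure.toSignedMeasure_apply_measurable] using h.symm
  have huniv := hsJ Set.univ MeasurableSet.univ
  simp only [probReal_univ, sub_self] at huniv
  have hvar : StrongMarkovProcess.varDist μ ν = 2 * J.posPart Set.univ := by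
    have h1 : J.negPart Set.univ = J.posPart Set.univ := by
      rw [← ENNReal.toReal_eq_toReal_iff' (measure_ne_top _ _) (measure_ne_top _ _)]
      simp only [measureReal_def] at huniv
      linarith
    rw [StrongMarkovProcess.varDist, SignedMeasure.totalVariation, Measure.add_apply, ← hs,
      ← hJ, h1, two_mul]
  have hle : μ.real B ≤ ν.real B + J.posPart.real Set.univ := by
    have h1 := hsJ B hB
    have h2 : J.posPart.real B ≤ J.posPart.real Set.univ := measureReal_mono (Set.subset_univ _)
    have h3 : 0 ≤ J.negPart.real B := measureReal_nonneg
    linarith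
  rw [hvar, mul_comm, ENNReal.mul_div_cancel_right two_ne_zero ENNReal.ofNat_ne_top]
  rw [← ENNReal.toReal_le_toReal (measure_ne_top _ _)
    (ENNReal.add_ne_top.2 ⟨measure_ne_top _ _, measure_ne_top _ _⟩),
    ENNReal.toReal_add (measure_ne_top _ _) (measure_ne_top _ _)]
  exact hle

/-- On the Hahn set `s` where `ν ≤ μ`, the excess of `∫ f` is at most the excess of mass because `1
- f ≥ 0`; on the complement `μ ≤ ν`. Adding `∫ (1 - f)` to both sides avoids subtraction in `ℝ≥0∞`.
-/
theorem lintegral_le_add_of_measure_le_add {μ ν : Measure S} [IsFiniteMeasure μ]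
    [IsFiniteMeasure ν] {ρ : ℝ≥0∞} (h : ∀ B, MeasurableSet B → μ B ≤ ν B + ρ) {f : S → ℝ≥0∞}
    (hf : Measurable f) (hf1 : ∀ x, f x ≤ 1) : ∫⁻ x, f x ∂μ ≤ ∫⁻ x, f x ∂ν + ρ := by
  obtain ⟨s, hs, h1, h2⟩ := hahn_decomposition μ ν
  have hle : μ.restrict sᶜ ≤ ν.restrict sᶜ := by
    refine Measure.le_iff.2 fun t ht => ?_
    rw [Measure.restrict_apply ht, Measure.restrict_apply ht]
    exact h2 _ (ht.inter hs.compl) Set.inter_subset_right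
  have hge : ν.restrict s ≤ μ.restrict s := by
    refine Measure.le_iff.2 fun t ht => ?_
    rw [Measure.restrict_apply ht, Measure.restrict_apply ht]
    exact h1 _ (ht.inter hs) Set.inter_subset_right
  have hsum : ∀ κ : Measure S, ∫⁻ x in s, f x ∂κ + ∫⁻ x in s, (1 - f x) ∂κ = κ s := by
    intro κ
    rw [← lintegral_add_left hf, ← setLIntegral_one]
    exact lintegral_congr fun x => add_tsub_cancel_of_le (hf1 x)
  have hfin : ∫⁻ x in s, (1 - f x) ∂ν ≠ ∞ := by
    refine ne_top_of_le_ne_top (measure_ne_top ν s) ?_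
    rw [← hsum ν]
    exact le_add_self
  have hmain : ∫⁻ x in s, f x ∂μ ≤ ∫⁻ x in s, f x ∂ν + ρ := by
    refine (ENNReal.add_le_add_iff_right hfin).1 ?_
    calc ∫⁻ x in s, f x ∂μ + ∫⁻ x in s, (1 - f x) ∂ν
        ≤ ∫⁻ x in s, f x ∂μ + ∫⁻ x in s, (1 - f x) ∂μ := by gcongr
      _ = μ s := hsum μ
      _ ≤ ν s + ρ := h s hs
      _ = ∫⁻ x in s, f x ∂ν + ρ + ∫⁻ x in s, (1 - f x) ∂ν := by rw [← hsum ν]; ring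
  rw [← lintegral_add_compl f hs, ← lintegral_add_compl f hs (μ := ν)]
  calc ∫⁻ x in s, f x ∂μ + ∫⁻ x in sᶜ, f x ∂μ
      ≤ (∫⁻ x in s, f x ∂ν + ρ) + ∫⁻ x in sᶜ, f x ∂ν := by gcongr
    _ = _ := by ring

end TotalVariation

section MaximalCoupling

variable {A S : Type*} [MeasurableSpace A] [MeasurableSpace S]

theorem map_fst_inv_smul_prod {r r' : Measure S} [IsFiniteMeasure r] [IsFiniteMeasure r']
    (h : r Set.univ = r' Set.univ) : ((r Set.univ)⁻¹ • r.prod r').map Prod.fst = r := by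
  rw [Measure.map_smul, Measure.map_fst_prod, ← h]
  -- With zero mass the factor is `0⁻¹ = ∞`, which is harmless because the product measure vanishes.
  rcases eq_or_ne (r Set.univ) 0 with h0 | h0
  · rw [Measure.measure_univ_eq_zero.1 h0]
    simp
  · rw [smul_smul, ENNReal.inv_mul_cancel h0 (measure_ne_top _ _), one_smul]

theorem map_snd_inv_smul_prod {r r' : Measure S} [IsFiniteMeasure r] [IsFiniteMeasure r']
    (h : r Set.univ = r' Set.univ) : ((r Set.univ)⁻¹ • r.prod r').map Prod.snd = r' := by
  rw [Measure.map_smul, Measure.map_snd_prod, h]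
  rcases eq_or_ne (r' Set.univ) 0 with h0 | h0
  · rw [Measure.measure_univ_eq_zero.1 h0]
    simp
  · rw [smul_smul, ENNReal.inv_mul_cancel h0 (measure_ne_top _ _), one_smul]

/-- The decomposition of two kernels into a common part and residual parts, the first residual
part being carried by a set of positivity of the difference. -/
theorem exists_common_part [MeasurableSpace.CountableOrCountablyGenerated A S]
    (κ η : Kernel A S) [IsMarkovKernel κ] [IsMarkovKernel η] :
    ∃ c r r' : Kernel A S, (∀ a, c a + r a = κ a) ∧ (∀ a, c a + r' a = η a) ∧
      ∀ a, ∃ B, MeasurableSet B ∧ κ a B = η a B + r a Set.univ := by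
  have hκ : ∀ a, κ a ≪ (κ + η) a := fun a => by
    rw [_root_.add_apply]; exact Measure.AbsolutelyContinuous.rfl.add_right _
  have hη : ∀ a, η a ≪ (κ + η) a := fun a => by
    rw [_root_.add_apply, add_comm]; exact Measure.AbsolutelyContinuous.rfl.add_right _
  set f := κ.rnDeriv (κ + η)
  set h := η.rnDeriv (κ + η)
  have hf : Measurable (Function.uncurry f) := Kernel.measurable_rnDeriv _ _
  have hh : Measurable (Function.uncurry h) := Kernel.measurable_rnDeriv _ _
  -- Densities with respect to the sum of the kernels make the common part, their minimum, jointly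
  -- measurable in the parameter.
  let m : A → S → ℝ≥0∞ := fun a x => min (f a x) (h a x)
  have hm : Measurable (Function.uncurry m) := hf.min hh
  have hκf : (κ + η).withDensity f = κ := Kernel.ext fun a => Kernel.withDensity_rnDeriv_eq (hκ a)
  have hηh : (κ + η).withDensity h = η := Kernel.ext fun a => Kernel.withDensity_rnDeriv_eq (hη a)
  let c := (κ + η).withDensity m
  let r := (κ + η).withDensity (fun a x => f a x - m a x)
  let r' := (κ + η).withDensity (fun a x => h a x - m a x)
  have h1 : ∀ a, c a + r a = κ a := fun a => by
    rw [add_comm, ← _root_.add_apply, Kernel.withDensity_sub_add_cancel hf hm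
      (fun a => Eventually.of_forall fun x => min_le_left _ _), hκf]
  have h2 : ∀ a, c a + r' a = η a := fun a => by
    rw [add_comm, ← _root_.add_apply, Kernel.withDensity_sub_add_cancel hh hm
      (fun a => Eventually.of_forall fun x => min_le_right _ _), hηh]
  refine ⟨c, r, r', h1, h2, fun a => ⟨{x | h a x < f a x}, ?_, ?_⟩⟩
  · exact measurableSet_lt (hh.comp measurable_prodMk_left) (hf.comp measurable_prodMk_left)
  · have hB : MeasurableSet {x | h a x < f a x} :=
      measurableSet_lt (hh.comp measurable_prodMk_left) (hf.comp measurable_prodMk_left)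
    have e1 : r a {x | h a x < f a x}ᶜ = 0 := by
      rw [Kernel.withDensity_apply' _ (hf.sub hm)]
      refine setLIntegral_eq_zero hB.compl fun x hx => ?_
      have : f a x ≤ h a x := not_lt.1 hx
      simp [m, this]
    have e2 : r' a {x | h a x < f a x} = 0 := by
      rw [Kernel.withDensity_apply' _ (hh.sub hm)]
      refine setLIntegral_eq_zero hB fun x hx => ?_
      have : h a x < f a x := hx
      simp [m, this.le]
    rw [← h1 a, ← h2 a, Measure.add_apply, Measure.add_apply, e2, add_zero,
      ← measure_add_measure_compl hB (μ := r a), e1, add_zero]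

/-- Existence of a measurable maximal coupling of two kernels. The cost of not being coupled is
controlled by the total variation distance and the moments of the marginals. -/
theorem exists_maximalCoupling [MeasurableSpace.CountableOrCountablyGenerated A S] [MeasurableEq S]
    (κ η : Kernel A S) [IsMarkovKernel κ] [IsMarkovKernel η] :
    ∃ Γ : Kernel A (S × S), (∀ a, (Γ a).map Prod.fst = κ a) ∧ (∀ a, (Γ a).map Prod.snd = η a) ∧
      ∀ a (ρ : ℝ≥0∞), (∀ B, MeasurableSet B → κ a B ≤ η a B + ρ) → ∀ w : S → ℝ≥0∞, Measurable w →
        ∫⁻ z, {z : S × S | z.1 ≠ z.2}.indicator (fun z => (1 + w z.1) + (1 + w z.2)) z ∂(Γ a) ≤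
          2 * ρ + (∫⁻ x, w x ∂(κ a) + ∫⁻ x, w x ∂(η a)) := by
  obtain ⟨c, r, r', hcr, hcr', hB⟩ := exists_common_part κ η
  have hrκ : ∀ a, r a ≤ κ a := fun a => by rw [← hcr]; exact Measure.le_add_left le_rfl
  have hrη : ∀ a, r' a ≤ η a := fun a => by rw [← hcr']; exact Measure.le_add_left le_rfl
  have hcκ : ∀ a, c a ≤ κ a := fun a => by rw [← hcr]; exact Measure.le_add_right le_rfl
  have hr : IsFiniteKernel r := ⟨1, ENNReal.one_lt_top, fun a => (hrκ a _).trans prob_le_one⟩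
  have hr' : IsFiniteKernel r' := ⟨1, ENNReal.one_lt_top, fun a => (hrη a _).trans prob_le_one⟩
  have hc : IsFiniteKernel c := ⟨1, ENNReal.one_lt_top, fun a => (hcκ a _).trans prob_le_one⟩
  have hmass : ∀ a, r a Set.univ = r' a Set.univ := by
    intro a
    have h1 := congrArg (fun μ => μ Set.univ) (hcr a)
    have h2 := congrArg (fun μ => μ Set.univ) (hcr' a)
    simp only [Measure.add_apply, measure_univ] at h1 h2
    exact (ENNReal.add_right_inj (measure_ne_top (c a) _)).1 (h1.trans h2.symm)
  have hdiag : Measurable (fun x : S => (x, x)) := measurable_id.prodMk measurable_id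
  have hinv : Measurable (Function.uncurry fun (a : A) (_ : S × S) => (r a Set.univ)⁻¹) :=
    ((r.measurable_coe MeasurableSet.univ).comp measurable_fst).inv
  -- The common part goes on the diagonal; the residuals, which have equal mass, are coupled
  -- independently.
  let Γ : Kernel A (S × S) := c.map (fun x => (x, x)) +
    (r ×ₖ r').withDensity (fun a _ => (r a Set.univ)⁻¹)
  have hΓ : ∀ a, Γ a = (c a).map (fun x => (x, x)) + (r a Set.univ)⁻¹ • (r a).prod (r' a) := by
    intro a
    rw [_root_.add_apply, Kernel.map_apply _ hdiag, Kernel.withDensity_apply _ hinv,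
      withDensity_const, Kernel.prod_apply]
  refine ⟨Γ, fun a => ?_, fun a => ?_, fun a ρ hρ w hw => ?_⟩
  · rw [hΓ, Measure.map_add _ _ measurable_fst, map_fst_inv_smul_prod (hmass a),
      Measure.map_map measurable_fst hdiag, ← hcr]
    congr 1
    exact Measure.map_id
  · rw [hΓ, Measure.map_add _ _ measurable_snd, map_snd_inv_smul_prod (hmass a),
      Measure.map_map measurable_snd hdiag, ← hcr']
    congr 1
    exact Measure.map_id
  · have hne : MeasurableSet {z : S × S | z.1 ≠ z.2} := measurableSet_diagonal.compl
    have hw1 : Measurable (fun x => 1 + w x) := hw.const_add 1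
    have hW : Measurable (fun z : S × S => (1 + w z.1) + (1 + w z.2)) :=
      (hw1.comp measurable_fst).add (hw1.comp measurable_snd)
    -- The set on which the difference of the marginals equals the residual mass turns the bound
    -- over all sets into a bound on that mass.
    have hrρ : r a Set.univ ≤ ρ := by
      obtain ⟨B, hBm, hB⟩ := hB a
      refine (ENNReal.add_le_add_iff_left (measure_ne_top (η a) B)).1 ?_
      rw [← hB]
      exact hρ B hBm
    rw [hΓ, lintegral_add_measure, lintegral_map (hW.indicator hne) hdiag]
    have h0 : ∀ x : S, {z : S × S | z.1 ≠ z.2}.indicator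
        (fun z => (1 + w z.1) + (1 + w z.2)) (x, x) = 0 := fun x =>
      Set.indicator_of_notMem (by simp) _
    simp_rw [h0, lintegral_zero, zero_add]
    calc ∫⁻ z, {z : S × S | z.1 ≠ z.2}.indicator (fun z => (1 + w z.1) + (1 + w z.2)) z
          ∂((r a Set.univ)⁻¹ • (r a).prod (r' a))
        ≤ ∫⁻ z, (1 + w z.1) + (1 + w z.2) ∂((r a Set.univ)⁻¹ • (r a).prod (r' a)) :=
          lintegral_mono (Set.indicator_le_self _ _)
      _ = ∫⁻ x, 1 + w x ∂(r a) + ∫⁻ x, 1 + w x ∂(r' a) := by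
          refine (lintegral_add_left (hw1.comp measurable_fst) _).trans ?_
          congr 1
          · refine (lintegral_map hw1 measurable_fst).symm.trans ?_
            rw [map_fst_inv_smul_prod (hmass a)]
          · refine (lintegral_map hw1 measurable_snd).symm.trans ?_
            rw [map_snd_inv_smul_prod (hmass a)]
      _ = 2 * r a Set.univ + (∫⁻ x, w x ∂(r a) + ∫⁻ x, w x ∂(r' a)) := by
          rw [lintegral_add_left measurable_const, lintegral_add_left measurable_const,
            lintegral_one, lintegral_one, ← hmass a]
          ring
      _ ≤ 2 * ρ + (∫⁻ x, w x ∂(κ a) + ∫⁻ x, w x ∂(η a)) := by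
          gcongr
          exacts [hrκ a, hrη a]

end MaximalCoupling

theorem isMarkovKernel_of_map_fst {A S S' : Type*} [MeasurableSpace A] [MeasurableSpace S]
    [MeasurableSpace S'] {Γ : Kernel A (S × S')} {κ : A → Measure S}
    [∀ a, IsProbabilityMeasure (κ a)] (h : ∀ a, (Γ a).map Prod.fst = κ a) : IsMarkovKernel Γ := by
  refine ⟨fun a => ⟨?_⟩⟩
  have h1 := congrArg (fun μ => μ Set.univ) (h a)
  simpa [Measure.map_apply measurable_fst MeasurableSet.univ] using h1

/-! ### Coupling of trajectories over one time step. -/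

namespace StrongMarkovProcess

section StepCoupling

variable {E : Type*} [TopologicalSpace E] [PolishSpace E] [MeasurableSpace E] [BorelSpace E]
  [Nonempty E] (X : StrongMarkovProcess E)

/-- Conditional distribution of the trajectory started at `p.1` given that it is at `p.2` at
time `T`. -/
theorem exists_bridge (T : ℝ≥0) : ∃ b : Kernel (E × E) (CadlagPath E), IsMarkovKernel b ∧
    ∀ x A B, MeasurableSet A → MeasurableSet B →
      (X.law x).map (fun ω => (ω T, ω)) (A ×ˢ B) = ∫⁻ z in A, b (x, z) B ∂(X.transition T x) := by
  have : Nonempty (CadlagPath E) := ⟨CadlagPath.const (Classical.arbitrary E)⟩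
  have hm : Measurable (fun ω : CadlagPath E => (ω T, ω)) :=
    (measurable_coord T).prodMk measurable_id
  let κ : Kernel E (E × CadlagPath E) := X.law.map (fun ω => (ω T, ω))
  have : IsMarkovKernel κ := Kernel.IsMarkovKernel.map _ hm
  have hfst : κ.fst = X.transition T := by
    ext1 x
    rw [Kernel.fst_apply, Kernel.map_apply _ hm, Measure.map_map measurable_fst hm,
      transition_apply]
    rfl
  refine ⟨κ.condKernel, inferInstance, fun x A B hA hB => ?_⟩
  have h := DFunLike.congr_fun (κ.disintegrate κ.condKernel) x
  rw [← Kernel.map_apply _ hm, ← hfst]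
  change κ x (A ×ˢ B) = _
  rw [← h, Kernel.compProd_apply_prod hA hB]

/-- A coupling of the trajectories started from two points, which is the diagonal one when the
points coincide and realizes a maximal coupling of the positions at time `T` otherwise. -/
theorem exists_stepCoupling (T : ℝ≥0) :
    ∃ Q : Kernel (E × E) (CadlagPath E × CadlagPath E),
      (∀ p, (Q p).map Prod.fst = X.law p.1) ∧ (∀ p, (Q p).map Prod.snd = X.law p.2) ∧
      (∀ x, Q (x, x) = (X.law x).map (fun ω => (ω, ω))) ∧
      ∀ x y, x ≠ y → ∀ ρ : ℝ≥0∞,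
        (∀ B, MeasurableSet B → X.transition T x B ≤ X.transition T y B + ρ) →
        ∀ w : E → ℝ≥0∞, Measurable w →
          ∫⁻ z, {z : CadlagPath E × CadlagPath E | z.1 T ≠ z.2 T}.indicator
            (fun z => (1 + w (z.1 T)) + (1 + w (z.2 T))) z ∂(Q (x, y)) ≤
          2 * ρ + (∫⁻ u, w u ∂(X.transition T x) + ∫⁻ u, w u ∂(X.transition T y)) := by
  classical
  obtain ⟨Γ, hΓ1, hΓ2, hΓ⟩ := exists_maximalCoupling
    ((X.transition T).comap Prod.fst (measurable_fst (α := E) (β := E)))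
    ((X.transition T).comap Prod.snd (measurable_snd (α := E) (β := E)))
  have hΓM : IsMarkovKernel Γ := isMarkovKernel_of_map_fst hΓ1
  obtain ⟨b, hbM, hb⟩ := X.exists_bridge T
  have hp1 : Measurable (fun p : (E × E) × (E × E) => (p.1.1, p.2.1)) := by fun_prop
  have hp2 : Measurable (fun p : (E × E) × (E × E) => (p.1.2, p.2.2)) := by fun_prop
  -- First draw the positions at time `T` from the maximal coupling, then fill in the two
  -- trajectories by conditionally independent bridges.
  let J : Kernel (E × E) ((E × E) × (CadlagPath E × CadlagPath E)) :=
    Γ ⊗ₖ ((b.comap _ hp1) ×ₖ (b.comap _ hp2))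
  have hq : ∀ t : ℝ≥0, Measurable (fun ω : CadlagPath E => (ω t, ω)) := fun t =>
    (measurable_coord t).prodMk measurable_id
  have hr1 : Measurable (fun p : (E × E) × (CadlagPath E × CadlagPath E) => (p.1.1, p.2.1)) := by
    fun_prop
  have hr2 : Measurable (fun p : (E × E) × (CadlagPath E × CadlagPath E) => (p.1.2, p.2.2)) := by
    fun_prop
  have hJ1 : ∀ p, (J p).map (fun p => (p.1.1, p.2.1)) = (X.law p.1).map (fun ω => (ω T, ω)) := by
    intro p
    have := Measure.isProbabilityMeasure_map hr1.aemeasurable (μ := J p)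
    refine Measure.ext_prod fun {A B} hA hB => ?_
    have hbB : Measurable (fun z => b (p.1, z) B) :=
      (b.measurable_coe hB).comp measurable_prodMk_left
    have e : (fun p : (E × E) × (CadlagPath E × CadlagPath E) => (p.1.1, p.2.1)) ⁻¹' (A ×ˢ B) =
        (Prod.fst ⁻¹' A) ×ˢ (Prod.fst ⁻¹' B) := rfl
    have hΓp : (Γ p).map Prod.fst = X.transition T p.1 := hΓ1 p
    rw [hb p.1 A B hA hB, Measure.map_apply hr1 (hA.prod hB), e,
      Kernel.compProd_apply_prod (measurable_fst hA) (measurable_fst hB), ← hΓp,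
      setLIntegral_map hA hbB measurable_fst]
    refine lintegral_congr fun z => ?_
    rw [Kernel.prod_apply, ← Measure.map_apply measurable_fst hB, Measure.map_fst_prod]
    simp
  have hJ2 : ∀ p, (J p).map (fun p => (p.1.2, p.2.2)) = (X.law p.2).map (fun ω => (ω T, ω)) := by
    intro p
    have := Measure.isProbabilityMeasure_map hr2.aemeasurable (μ := J p)
    refine Measure.ext_prod fun {A B} hA hB => ?_
    have hbB : Measurable (fun z => b (p.2, z) B) :=
      (b.measurable_coe hB).comp measurable_prodMk_left
    have e : (fun p : (E × E) × (CadlagPath E × CadlagPath E) => (p.1.2, p.2.2)) ⁻¹' (A ×ˢ B) =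
        (Prod.snd ⁻¹' A) ×ˢ (Prod.snd ⁻¹' B) := rfl
    have hΓp : (Γ p).map Prod.snd = X.transition T p.2 := hΓ2 p
    rw [hb p.2 A B hA hB, Measure.map_apply hr2 (hA.prod hB), e,
      Kernel.compProd_apply_prod (measurable_snd hA) (measurable_snd hB), ← hΓp,
      setLIntegral_map hA hbB measurable_snd]
    refine lintegral_congr fun z => ?_
    rw [Kernel.prod_apply, ← Measure.map_apply measurable_snd hB, Measure.map_snd_prod]
    simp
  have hdiag : Measurable (fun ω : CadlagPath E => (ω, ω)) := measurable_id.prodMk measurable_id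
  have hJsnd1 : ∀ p, (J.snd p).map Prod.fst = X.law p.1 := by
    intro p
    have h := congrArg (Measure.map Prod.snd) (hJ1 p)
    rw [Measure.map_map measurable_snd hr1, Measure.map_map measurable_snd (hq T)] at h
    rw [Kernel.snd_apply, Measure.map_map measurable_fst measurable_snd]
    refine Eq.trans h ?_
    exact Measure.map_id
  have hJsnd2 : ∀ p, (J.snd p).map Prod.snd = X.law p.2 := by
    intro p
    have h := congrArg (Measure.map Prod.snd) (hJ2 p)
    rw [Measure.map_map measurable_snd hr2, Measure.map_map measurable_snd (hq T)] at h
    rw [Kernel.snd_apply, Measure.map_map measurable_snd measurable_snd]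
    refine Eq.trans h ?_
    exact Measure.map_id
  -- Independent bridges would separate coinciding paths before time `T`; on the diagonal the same
  -- path is used twice, so coupled trajectories agree at all times.
  let Q := Kernel.piecewise (measurableSet_diagonal (α := E))
    ((X.law.comap Prod.fst (measurable_fst (α := E) (β := E))).map (fun ω => (ω, ω))) J.snd
  have hQdiag : ∀ x, Q (x, x) = (X.law x).map (fun ω => (ω, ω)) := by
    intro x
    have hx : (x, x) ∈ Set.diagonal E := rfl
    rw [Kernel.piecewise_apply, if_pos hx, Kernel.map_apply _ hdiag, Kernel.comap_apply]
  have hQoff : ∀ x y, x ≠ y → Q (x, y) = J.snd (x, y) := by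
    intro x y hxy
    have hx : (x, y) ∉ Set.diagonal E := hxy
    rw [Kernel.piecewise_apply, if_neg hx]
  refine ⟨Q, ?_, ?_, hQdiag, ?_⟩
  · rintro ⟨x, y⟩
    rcases eq_or_ne x y with rfl | hxy
    · rw [hQdiag, Measure.map_map measurable_fst hdiag]
      exact Measure.map_id
    · rw [hQoff x y hxy, hJsnd1]
  · rintro ⟨x, y⟩
    rcases eq_or_ne x y with rfl | hxy
    · rw [hQdiag, Measure.map_map measurable_snd hdiag]
      exact Measure.map_id
    · rw [hQoff x y hxy, hJsnd2]
  · intro x y hxy ρ hρ w hw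
    have hgraph : MeasurableSet {q : E × CadlagPath E | q.1 = q.2 T} :=
      measurableSet_eq_fun measurable_fst ((measurable_coord T).comp measurable_snd)
    have hae1 : ∀ᵐ p ∂(J (x, y)), p.1.1 = p.2.1 T := by
      have h : ∀ᵐ q ∂(X.law x).map (fun ω => (ω T, ω)), q.1 = q.2 T :=
        (ae_map_iff (hq T).aemeasurable hgraph).2 (Eventually.of_forall fun _ => rfl)
      rw [← hJ1 (x, y)] at h
      exact ae_of_ae_map hr1.aemeasurable h
    have hae2 : ∀ᵐ p ∂(J (x, y)), p.1.2 = p.2.2 T := by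
      have h : ∀ᵐ q ∂(X.law y).map (fun ω => (ω T, ω)), q.1 = q.2 T :=
        (ae_map_iff (hq T).aemeasurable hgraph).2 (Eventually.of_forall fun _ => rfl)
      rw [← hJ2 (x, y)] at h
      exact ae_of_ae_map hr2.aemeasurable h
    let F : E × E → ℝ≥0∞ := {z : E × E | z.1 ≠ z.2}.indicator
      (fun z => (1 + w z.1) + (1 + w z.2))
    have hF : Measurable F :=
      (((hw.comp measurable_fst).const_add 1).add ((hw.comp measurable_snd).const_add 1)).indicator
        measurableSet_diagonal.compl
    have hFT : Measurable (fun z : CadlagPath E × CadlagPath E => F (z.1 T, z.2 T)) :=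
      hF.comp (((measurable_coord T).comp measurable_fst).prodMk
        ((measurable_coord T).comp measurable_snd))
    rw [hQoff x y hxy]
    calc ∫⁻ z, F (z.1 T, z.2 T) ∂(J.snd (x, y))
        = ∫⁻ p, F (p.2.1 T, p.2.2 T) ∂(J (x, y)) := by
          rw [Kernel.snd_apply, lintegral_map hFT measurable_snd]
      _ = ∫⁻ p, F p.1 ∂(J (x, y)) := by
          refine lintegral_congr_ae ?_
          filter_upwards [hae1, hae2] with p h1 h2
          rw [← h1, ← h2]
      _ = ∫⁻ z, F z ∂(Γ (x, y)) := by
          rw [← lintegral_map hF measurable_fst, ← Kernel.fst_apply, Kernel.fst_compProd]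
      _ ≤ _ := hΓ (x, y) ρ hρ w hw

end StepCoupling

end StrongMarkovProcess

/-! ### Constants for the weighted contraction. -/

section Contraction

/-- The constants in the contraction estimate for a weighted total variation distance. -/
theorem exists_contraction_constants (γ M : ℝ≥0) (hγ : γ < 1) :
    ∃ R : ℝ≥0, ∀ ρ₀ : ℝ≥0, ρ₀ < 1 → ∃ β ρ : ℝ≥0, 0 < β ∧ 0 < ρ ∧ ρ < 1 ∧ ∀ s : ℝ≥0,
      (R ≤ s → 2 + β * (γ * s + 2 * M) ≤ ρ * (2 + β * s)) ∧
      2 * ρ₀ + β * (γ * s + 2 * M) ≤ ρ * (2 + β * s) := by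
  have hγ' : (γ : ℝ) < 1 := hγ
  have h1γ : (0 : ℝ) < 1 - γ := by linarith
  have hM : (0 : ℝ) ≤ M := M.2
  have hγ0 : (0 : ℝ) ≤ γ := γ.2
  -- For `s ≥ R`, half of the gain `β(1 - γ)s` is at least `2Mβ + β`: it pays for the drift constant
  -- and leaves `β`. The value does not involve `ρ₀`, since `ρ₀` will come from the Doeblin
  -- condition on a level set determined by `R`.
  obtain ⟨R, hR'⟩ : ∃ R : ℝ≥0, (R : ℝ) = 2 * (2 * M + 1) / (1 - γ) :=
    CanLift.prf (2 * (2 * M + 1) / (1 - γ) : ℝ) (by positivity)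
  refine ⟨R, fun ρ₀ hρ₀ => ?_⟩
  have hρ₀' : (ρ₀ : ℝ) < 1 := hρ₀
  have hρ₀0 : (0 : ℝ) ≤ ρ₀ := ρ₀.2
  set δ : ℝ := 1 - ρ₀ with hδ
  have hδ0 : 0 < δ := by linarith
  -- This is small enough that the drift term `2Mβ` uses at most `δ`, half of the Doeblin gain `2δ`.
  set β : ℝ := δ / (2 * M + 1) with hβ
  have hβ0 : 0 < β := by positivity
  have hβM : 2 * M * β ≤ δ := by
    rw [hβ, mul_div_assoc', div_le_iff₀ (by positivity)]
    nlinarith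
  -- The three terms handle the constant `2` for small `s`, the slope in `βs`, and the constant `2`
  -- for large `s`.
  set ρ : ℝ := max (max (1 - δ / 2) ((1 + γ) / 2)) (1 - β / 2) with hρ
  have e1 : 1 - δ / 2 ≤ ρ := (le_max_left _ _).trans (le_max_left _ _)
  have e2 : (1 + γ) / 2 ≤ ρ := (le_max_right _ _).trans (le_max_left _ _)
  have e3 : 1 - β / 2 ≤ ρ := le_max_right _ _
  have hρ1 : ρ < 1 := max_lt (max_lt (by linarith) (by linarith)) (by linarith)
  have hρ0 : 0 < ρ := by linarith
  obtain ⟨b, hb⟩ : ∃ b : ℝ≥0, (b : ℝ) = β := CanLift.prf β hβ0.le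
  obtain ⟨r, hr⟩ : ∃ r : ℝ≥0, (r : ℝ) = ρ := CanLift.prf ρ hρ0.le
  refine ⟨b, r, by rwa [← NNReal.coe_pos, hb], by rwa [← NNReal.coe_pos, hr],
    by rwa [← NNReal.coe_lt_coe, hr, NNReal.coe_one], fun s => ?_⟩
  have hs : (0 : ℝ) ≤ s := s.2
  have hβs : 0 ≤ β * s := by positivity
  rw [← NNReal.coe_le_coe, ← NNReal.coe_le_coe, ← NNReal.coe_le_coe]
  push_cast
  rw [hb, hr, hR']
  constructor
  · intro hR
    rw [div_le_iff₀ h1γ] at hR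
    have h2 : β * (2 * (2 * M + 1)) ≤ β * (s * (1 - γ)) := mul_le_mul_of_nonneg_left hR hβ0.le
    have h3 : (1 + γ) / 2 * (β * s) ≤ ρ * (β * s) := mul_le_mul_of_nonneg_right e2 hβs
    nlinarith
  · have h3 : (1 + γ) / 2 * (β * s) ≤ ρ * (β * s) := mul_le_mul_of_nonneg_right e2 hβs
    have h4 : γ * (β * s) ≤ (1 + γ) / 2 * (β * s) :=
      mul_le_mul_of_nonneg_right (by linarith) hβs
    nlinarith

end Contraction

/-! ### Markov chains and their sequences of states. -/

section MarkovChain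

/-- The Markov chain with a given transition kernel, as a kernel from the initial states to the
sequences of states. -/
theorem exists_markovChain {S : Type*} [MeasurableSpace S] (K : Kernel S S) [IsMarkovKernel K] :
    ∃ chain : Kernel S (ℕ → S), IsMarkovKernel chain ∧
      (∀ s, (chain s).map (fun w => w 0) = Measure.dirac s) ∧
      ∀ s n, (chain s).map (fun w => ((fun i => w (min i n) : ℕ → S), w (n + 1))) =
        ((chain s).map (fun w => (fun i => w (min i n) : ℕ → S))) ⊗ₘ
          K.comap (fun w : ℕ → S => w n) (measurable_pi_apply n) := by
  let κ : (n : ℕ) → Kernel (Π _ : Finset.Iic n, S) S := fun n =>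
    K.comap (fun p => p ⟨n, Finset.mem_Iic.2 le_rfl⟩) (measurable_pi_apply _)
  let start : S → (Π _ : Finset.Iic 0, S) := fun s _ => s
  have hstart : Measurable start := measurable_pi_iff.2 fun _ => measurable_id
  let chain : Kernel S (ℕ → S) := (Kernel.traj (X := fun _ => S) κ 0).comap start hstart
  have hchain : ∀ s, chain s = Kernel.traj (X := fun _ => S) κ 0 (start s) := fun s => rfl
  refine ⟨chain, inferInstance, fun s => ?_, fun s n => ?_⟩
  · have h := Kernel.traj_map_frestrictLe_apply (X := fun _ => S) (κ := κ) 0 0 (start s)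
    rw [Kernel.partialTraj_self, Kernel.id_apply] at h
    have h0 : Measurable (fun p : Π _ : Finset.Iic 0, S => p ⟨0, Finset.mem_Iic.2 le_rfl⟩) :=
      measurable_pi_apply _
    have h' := congrArg (Measure.map fun p => p ⟨0, Finset.mem_Iic.2 le_rfl⟩) h
    rw [Measure.map_map h0 (by fun_prop), Measure.map_dirac' h0] at h'
    exact h'
  -- The finite history is extended by its last value, so that all pasts live in the single space `ℕ
  -- → S`.
  · let ext : (Π _ : Finset.Iic n, S) → (ℕ → S) := fun p i =>
      p ⟨min i n, Finset.mem_Iic.2 (min_le_right _ _)⟩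
    have hext : Measurable ext := measurable_pi_iff.2 fun i => measurable_pi_apply _
    have hres : Measurable (Preorder.frestrictLe (π := fun _ : ℕ => S) n) := by fun_prop
    have hpair : Measurable (fun w : ℕ → S =>
        (Preorder.frestrictLe (π := fun _ : ℕ => S) n w, w (n + 1))) := by fun_prop
    have h := Kernel.partialTraj_compProd_eq_map_traj (X := fun _ => S) (κ := κ)
      (zero_le (a := n)) (x₀ := start s)
    rw [← Kernel.traj_map_frestrictLe_apply, ← hchain] at h
    have h' := congrArg (Measure.map (Prod.map ext id)) h
    rw [Measure.map_map (hext.prodMap measurable_id) hpair] at h'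
    refine h'.symm.trans ?_
    have hcomp : (fun w : ℕ → S => (fun i => w (min i n) : ℕ → S)) =
        ext ∘ Preorder.frestrictLe (π := fun _ : ℕ => S) n := rfl
    have hcomp_meas : Measurable (fun w : ℕ → S => (fun i => w (min i n) : ℕ → S)) :=
      measurable_pi_iff.2 fun i => measurable_pi_apply _
    have hmn : ∀ p : Π _ : Finset.Iic n, S, ext p n = p ⟨n, Finset.mem_Iic.2 le_rfl⟩ := by
      intro p
      simp [ext]
    have hP := Measure.isProbabilityMeasure_map hres.aemeasurable (μ := chain s)
    have hP' := Measure.isProbabilityMeasure_map (hext.prodMap measurable_id).aemeasurable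
      (μ := ((chain s).map (Preorder.frestrictLe (π := fun _ : ℕ => S) n)) ⊗ₘ κ n)
    have hP'' := Measure.isProbabilityMeasure_map hcomp_meas.aemeasurable (μ := chain s)
    refine Measure.ext_prod fun {A B} hA hB => ?_
    have e : Prod.map ext id ⁻¹' (A ×ˢ B) = (ext ⁻¹' A) ×ˢ B := rfl
    rw [Measure.map_apply (hext.prodMap measurable_id) (hA.prod hB), e,
      Measure.compProd_apply_prod (hext hA) hB, Measure.compProd_apply_prod hA hB, hcomp,
      ← Measure.map_map hext hres, setLIntegral_map hA ?_ hext]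
    · refine lintegral_congr fun p => ?_
      rw [Kernel.comap_apply, Kernel.comap_apply, hmn]
    · exact (Kernel.measurable_coe _ hB)

end MarkovChain

theorem concatUpTo_congr {E : Type*} [TopologicalSpace E] (T : ℝ≥0) {w w' : ℕ → CadlagPath E}
    {n : ℕ} (h : ∀ i ≤ n, w i = w' i) : concatUpTo T w n = concatUpTo T w' n := by
  induction n with
  | zero => exact h 0 le_rfl
  | succ n ih => rw [concatUpTo, concatUpTo, ih fun i hi => h i (hi.trans n.le_succ), h _ le_rfl]

/-! ### Concatenating one-step couplings along a chain. -/

namespace StrongMarkovProcess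

section Chain

variable {E : Type*} [TopologicalSpace E] [MeasurableSpace E] (X : StrongMarkovProcess E)
  {S : Type*} [MeasurableSpace S] {K : Kernel S S} [IsMarkovKernel K] {μ : Measure (ℕ → S)}
  [IsProbabilityMeasure μ] {s : S}

/-- If each step of a Markov chain produces a trajectory of the process started from the end of the
previous one, then the concatenation of these trajectories is a trajectory of the process. -/
theorem map_concatUpTo_chain {T : ℝ≥0} (h0 : μ.map (fun w => w 0) = Measure.dirac s)
    (hstep : ∀ n, μ.map (fun w => ((fun i => w (min i n) : ℕ → S), w (n + 1))) =
      (μ.map (fun w => (fun i => w (min i n) : ℕ → S))) ⊗ₘ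
        K.comap (fun w : ℕ → S => w n) (measurable_pi_apply n))
    {pr : S → CadlagPath E} (hpr : Measurable pr) (hK : ∀ s, (K s).map pr = X.law (pr s T))
    (n : ℕ) : μ.map (fun w => concatUpTo T (fun k => pr (w (k + 1))) n) = X.law (pr s T) := by
  have hu : Measurable (fun (w : ℕ → S) (k : ℕ) => pr (w (k + 1))) :=
    measurable_pi_iff.2 fun k => hpr.comp (measurable_pi_apply _)
  have htrunc : ∀ n, Measurable (fun w : ℕ → S => (fun i => w (min i n) : ℕ → S)) := fun n =>
    measurable_pi_iff.2 fun i => measurable_pi_apply _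
  have hpair : ∀ n, Measurable (fun w : ℕ → S => ((fun i => w (min i n) : ℕ → S), w (n + 1))) :=
    fun n => (htrunc n).prodMk (measurable_pi_apply _)
  have hKB : ∀ s {B}, MeasurableSet B → K s (pr ⁻¹' B) = X.law (pr s T) B := fun s B hB => by
    rw [← hK, Measure.map_apply hpr hB]
  -- One-step Markov property for events `A` that depend only on the coordinates up to `n`.
  have hstep' : ∀ n {A : Set (ℕ → S)} {B : Set (CadlagPath E)}, MeasurableSet A →
      MeasurableSet B → (∀ w : ℕ → S, (fun i => w (min i n) : ℕ → S) ∈ A ↔ w ∈ A) →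
      μ (A ∩ {w | pr (w (n + 1)) ∈ B}) = ∫⁻ w in A, X.law (pr (w n) T) B ∂μ := by
    intro n A B hA hB hAn
    have hP := Measure.isProbabilityMeasure_map (htrunc n).aemeasurable (μ := μ)
    have h := DFunLike.congr_fun (hstep n) (A ×ˢ (pr ⁻¹' B))
    rw [Measure.map_apply (hpair n) (hA.prod (hpr hB)),
      Measure.compProd_apply_prod hA (hpr hB),
      setLIntegral_map hA (Kernel.measurable_coe _ (hpr hB)) (htrunc n)] at h
    have e1 : (fun w : ℕ → S => ((fun i => w (min i n) : ℕ → S), w (n + 1))) ⁻¹'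
        (A ×ˢ (pr ⁻¹' B)) = A ∩ {w | pr (w (n + 1)) ∈ B} := by
      ext w
      exact and_congr_left' (hAn w)
    have e2 : (fun w : ℕ → S => (fun i => w (min i n) : ℕ → S)) ⁻¹' A = A := by
      ext w
      exact hAn w
    rw [e1, e2] at h
    rw [h]
    refine lintegral_congr fun w => ?_
    change K (w (min n n)) _ = _
    rw [min_self, hKB _ hB]
  have hlawB : ∀ {B}, MeasurableSet B → Measurable (fun s => X.law (pr s T) B) := fun hB =>
    (X.law.measurable_coe hB).comp ((measurable_coord T).comp hpr)
  induction n with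
  | zero =>
    ext B hB
    have h0u : Measurable (fun w : ℕ → S => concatUpTo T (fun k => pr (w (k + 1))) 0) :=
      (measurable_concatUpTo T 0).comp hu
    rw [Measure.map_apply h0u hB]
    have h := hstep' 0 MeasurableSet.univ hB (fun _ => Iff.rfl)
    rw [Set.univ_inter, Measure.restrict_univ,
      ← lintegral_map (f := fun s => X.law (pr s T) B) (hlawB hB) (measurable_pi_apply 0), h0,
      lintegral_dirac' _ (hlawB hB)] at h
    exact h
  | succ n ih =>
    let H : (ℕ → S) → CadlagPath E := fun w => concatUpTo T (fun k => pr (w (k + 1))) n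
    have hH : Measurable H := (measurable_concatUpTo T n).comp hu
    have hHpr : Measurable (fun w => (H w, pr (w (n + 2)))) :=
      hH.prodMk (hpr.comp (measurable_pi_apply _))
    -- The next block is a fresh trajectory started from the end of the concatenated past; by
    -- `map_glue`, attaching it reproduces the law of the process.
    have hjoint : μ.map (fun w => (H w, pr (w (n + 2)))) =
        (X.law (pr s T)) ⊗ₘ X.law.comap (fun ω : CadlagPath E => ω ((n + 1 : ℕ) * T))
          (measurable_coord _) := by
      have hP := Measure.isProbabilityMeasure_map hHpr.aemeasurable (μ := μ)
      refine Measure.ext_prod fun {A B} hA hB => ?_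
      rw [Measure.map_apply hHpr (hA.prod hB), Measure.compProd_apply_prod hA hB, ← ih,
        setLIntegral_map hA (Kernel.measurable_coe _ hB) hH]
      refine (hstep' (n + 1) (hH hA) hB fun w => ?_).trans ?_
      · have : H (fun i => w (min i (n + 1))) = H w := by
          refine concatUpTo_congr T fun i hi => ?_
          change pr (w (min (i + 1) (n + 1))) = pr (w (i + 1))
          rw [min_eq_left (Nat.succ_le_succ hi)]
        rw [Set.mem_preimage, Set.mem_preimage, this]
      · refine lintegral_congr fun w => ?_
        have hle : (n : ℝ≥0) * T ≤ (n + 1 : ℕ) * T := by gcongr; exact n.le_succ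
        have : H w ((n + 1 : ℕ) * T) = pr (w (n + 1)) T := by
          rw [concatUpTo_apply_of_le T _ n hle]
          rw [Nat.cast_succ, add_mul, one_mul, add_tsub_cancel_left]
        rw [Kernel.comap_apply, this]
    rw [← X.map_glue (pr s T) ((n + 1 : ℕ) * T), ← hjoint,
      Measure.map_map (measurable_glue _) hHpr]
    rfl

/-- Stopped at `n * T`, the infinite concatenation equals the one with `n + 1` blocks, whose law is
known; the stopped laws determine the measure. -/
theorem map_concat_chain {T : ℝ≥0} (hT : 0 < T) (h0 : μ.map (fun w => w 0) = Measure.dirac s)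
    (hstep : ∀ n, μ.map (fun w => ((fun i => w (min i n) : ℕ → S), w (n + 1))) =
      (μ.map (fun w => (fun i => w (min i n) : ℕ → S))) ⊗ₘ
        K.comap (fun w : ℕ → S => w n) (measurable_pi_apply n))
    {pr : S → CadlagPath E} (hpr : Measurable pr) (hK : ∀ s, (K s).map pr = X.law (pr s T)) :
    μ.map (fun w => concat T hT (fun k => pr (w (k + 1)))) = X.law (pr s T) := by
  have hu : Measurable (fun (w : ℕ → S) (k : ℕ) => pr (w (k + 1))) :=
    measurable_pi_iff.2 fun k => hpr.comp (measurable_pi_apply _)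
  have hc : Measurable (fun w : ℕ → S => concat T hT (fun k => pr (w (k + 1)))) :=
    (measurable_concat T hT).comp hu
  have hcn : ∀ n, Measurable (fun w : ℕ → S => concatUpTo T (fun k => pr (w (k + 1))) n) :=
    fun n => (measurable_concatUpTo T n).comp hu
  have hP := Measure.isProbabilityMeasure_map hc.aemeasurable (μ := μ)
  refine measure_ext_of_stopAt (P := μ.map (fun w => concat T hT (fun k => pr (w (k + 1)))))
    (fun n : ℕ => (n : ℝ≥0) * T) ?_ ?_ fun n => ?_
  · exact tendsto_natCast_atTop_atTop.atTop_mul_const hT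
  · intro m n hmn
    dsimp only
    gcongr
  · rw [← X.map_concatUpTo_chain h0 hstep hpr hK n,
      Measure.map_map (measurable_stopAt _) hc,
      Measure.map_map (measurable_stopAt _) (hcn n)]
    congr 1
    funext w
    refine stopAt_concat hT _ n ?_
    gcongr
    exact n.lt_succ_self

theorem lintegral_chain_succ
    (hstep : ∀ n, μ.map (fun w => ((fun i => w (min i n) : ℕ → S), w (n + 1))) =
      (μ.map (fun w => (fun i => w (min i n) : ℕ → S))) ⊗ₘ
        K.comap (fun w : ℕ → S => w n) (measurable_pi_apply n))
    {F : S → ℝ≥0∞} (hF : Measurable F) (n : ℕ) :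
    ∫⁻ w, F (w (n + 1)) ∂μ = ∫⁻ w, ∫⁻ v, F v ∂(K (w n)) ∂μ := by
  have htrunc : Measurable (fun w : ℕ → S => (fun i => w (min i n) : ℕ → S)) :=
    measurable_pi_iff.2 fun i => measurable_pi_apply _
  have hpair : Measurable (fun w : ℕ → S => ((fun i => w (min i n) : ℕ → S), w (n + 1))) :=
    htrunc.prodMk (measurable_pi_apply _)
  have hP := Measure.isProbabilityMeasure_map htrunc.aemeasurable (μ := μ)
  have h := congrArg (fun ν => ∫⁻ q, F q.2 ∂ν) (hstep n)
  have hF2 : Measurable (fun q : (ℕ → S) × S => F q.2) := hF.comp measurable_snd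
  rw [lintegral_map hF2 hpair, Measure.lintegral_compProd hF2,
    lintegral_map (hF.lintegral_kernel (κ := K.comap
      (fun w : ℕ → S => w n) (measurable_pi_apply n))) htrunc] at h
  refine h.trans (lintegral_congr fun w => ?_)
  change ∫⁻ v, F v ∂(K (w (min n n))) = _
  rw [min_self]

end Chain

section CouplingKernel

variable {E : Type*} [TopologicalSpace E] [MeasurableSpace E] (X : StrongMarkovProcess E)

/-- Iteration of a coupling over time intervals of length `T`. -/
theorem exists_iterated_coupling {T : ℝ≥0} (hT : 0 < T)
    {Q : Kernel (E × E) (CadlagPath E × CadlagPath E)}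
    (hQ1 : ∀ p, (Q p).map Prod.fst = X.law p.1) (hQ2 : ∀ p, (Q p).map Prod.snd = X.law p.2) :
    ∃ R : Kernel (E × E) (CadlagPath E × CadlagPath E),
      (∀ p, (R p).map Prod.fst = X.law p.1) ∧ (∀ p, (R p).map Prod.snd = X.law p.2) ∧
      ∀ (D : E × E → ℝ≥0∞), Measurable D → ∀ ρ : ℝ≥0∞,
        (∀ p, ∫⁻ z, D (z.1 T, z.2 T) ∂(Q p) ≤ ρ * D p) →
        ∀ (F : E × E → ℝ≥0∞), Measurable F → ∀ (C : ℝ≥0∞) (t : ℝ≥0),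
          (∀ p, ∫⁻ z, F (z.1 (t - ⌊t / T⌋₊ * T), z.2 (t - ⌊t / T⌋₊ * T)) ∂(Q p) ≤ C * D p) →
          ∀ p, ∫⁻ z, F (z.1 t, z.2 t) ∂(R p) ≤ C * (ρ ^ ⌊t / T⌋₊ * D p) := by
  have hQM : IsMarkovKernel Q := isMarkovKernel_of_map_fst hQ1
  have heval : ∀ t : ℝ≥0, Measurable (fun z : CadlagPath E × CadlagPath E => (z.1 t, z.2 t)) :=
    fun t => ((measurable_coord t).comp measurable_fst).prodMk
      ((measurable_coord t).comp measurable_snd)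
  let K : Kernel (CadlagPath E × CadlagPath E) (CadlagPath E × CadlagPath E) :=
    Q.comap (fun z => (z.1 T, z.2 T)) (heval T)
  obtain ⟨chain, hM, h0, hstep⟩ := exists_markovChain K
  -- The chain starts from constant paths, so the position at `T` of state `0` is the starting
  -- point. State `0` is not part of the concatenation: block `k` is state `k + 1`.
  let init : E × E → CadlagPath E × CadlagPath E := fun p =>
    (CadlagPath.const p.1, CadlagPath.const p.2)
  have hinit : Measurable init :=
    (measurable_const_path.comp measurable_fst).prodMk (measurable_const_path.comp measurable_snd)
  let cc : (ℕ → CadlagPath E × CadlagPath E) → CadlagPath E × CadlagPath E := fun w =>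
    (concat T hT fun k => (w (k + 1)).1, concat T hT fun k => (w (k + 1)).2)
  have hcc : Measurable cc :=
    ((measurable_concat T hT).comp (measurable_pi_iff.2 fun k =>
      measurable_fst.comp (measurable_pi_apply (k + 1)))).prodMk
    ((measurable_concat T hT).comp (measurable_pi_iff.2 fun k =>
      measurable_snd.comp (measurable_pi_apply (k + 1))))
  let R : Kernel (E × E) (CadlagPath E × CadlagPath E) := (chain.comap init hinit).map cc
  have hR : ∀ p, R p = (chain (init p)).map cc := fun p => by
    rw [Kernel.map_apply _ hcc, Kernel.comap_apply]
  refine ⟨R, fun p => ?_, fun p => ?_, fun D hD ρ hDρ F hF C t hFC p => ?_⟩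
  · rw [hR, Measure.map_map measurable_fst hcc]
    exact X.map_concat_chain hT (h0 _) (hstep _) measurable_fst fun z => hQ1 _
  · rw [hR, Measure.map_map measurable_snd hcc]
    exact X.map_concat_chain hT (h0 _) (hstep _) measurable_snd fun z => hQ2 _
  · have hDn : ∀ n, ∫⁻ w, D ((w n).1 T, (w n).2 T) ∂(chain (init p)) ≤ ρ ^ n * D p := by
      intro n
      induction n with
      | zero =>
        have hDT : Measurable (fun z : CadlagPath E × CadlagPath E => D (z.1 T, z.2 T)) :=
          hD.comp (heval T)
        rw [← lintegral_map (f := fun z : CadlagPath E × CadlagPath E => D (z.1 T, z.2 T))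
          hDT (measurable_pi_apply 0), h0, lintegral_dirac' _ hDT, pow_zero, one_mul]
        exact le_rfl
      | succ n ih =>
        rw [lintegral_chain_succ (hstep (init p)) (F := fun z => D (z.1 T, z.2 T))
          (hD.comp (heval T)) n]
        calc ∫⁻ w, ∫⁻ v, D (v.1 T, v.2 T) ∂(K (w n)) ∂(chain (init p))
            ≤ ∫⁻ w, ρ * D ((w n).1 T, (w n).2 T) ∂(chain (init p)) :=
              lintegral_mono fun w => hDρ _
          _ = ρ * ∫⁻ w, D ((w n).1 T, (w n).2 T) ∂(chain (init p)) :=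
              lintegral_const_mul _ ((hD.comp (heval T)).comp (measurable_pi_apply n))
          _ ≤ ρ * (ρ ^ n * D p) := by gcongr
          _ = ρ ^ (n + 1) * D p := by ring
    -- There are `n` complete blocks; the position at `t` is read in state `n + 1` at the remaining
    -- time `r`.
    set n := ⌊t / T⌋₊
    set r := t - n * T
    have hFt : Measurable (fun z : CadlagPath E × CadlagPath E => F (z.1 t, z.2 t)) :=
      hF.comp (heval t)
    rw [hR, lintegral_map hFt hcc]
    calc ∫⁻ w, F ((cc w).1 t, (cc w).2 t) ∂(chain (init p))
        = ∫⁻ w, F ((w (n + 1)).1 r, (w (n + 1)).2 r) ∂(chain (init p)) := by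
          refine lintegral_congr fun w => ?_
          have e1 : (cc w).1 t = (w (n + 1)).1 r := concat_apply hT _ t
          have e2 : (cc w).2 t = (w (n + 1)).2 r := concat_apply hT _ t
          rw [e1, e2]
      _ = ∫⁻ w, ∫⁻ v, F (v.1 r, v.2 r) ∂(K (w n)) ∂(chain (init p)) :=
          lintegral_chain_succ (hstep (init p)) (F := fun z => F (z.1 r, z.2 r))
            (hF.comp (heval r)) n
      _ ≤ ∫⁻ w, C * D ((w n).1 T, (w n).2 T) ∂(chain (init p)) :=
          lintegral_mono fun w => hFC _
      _ = C * ∫⁻ w, D ((w n).1 T, (w n).2 T) ∂(chain (init p)) :=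
          lintegral_const_mul _ ((hD.comp (heval T)).comp (measurable_pi_apply n))
      _ ≤ C * (ρ ^ n * D p) := by gcongr; exact hDn n

end CouplingKernel

end StrongMarkovProcess

/-! ### Doeblin bound and geometric coupling. -/

namespace StrongMarkovProcess

section Doeblin

variable {E : Type*} [TopologicalSpace E] [MeasurableSpace E] (X : StrongMarkovProcess E)

/-- Total variation does not grow under a further transition, so the Doeblin time can be lengthened
by one. This ensures `1 ≤ T`, the range where the drift factor `γ` is available. -/
theorem exists_transition_le_add (hX : X.LocalDoeblin) {L : Set E} (hL : IsCompact L) :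
    ∃ T : ℝ≥0, 1 ≤ T ∧ ∃ ρ : ℝ≥0, ρ < 1 ∧ ∀ x ∈ L, ∀ y ∈ L, ∀ B, MeasurableSet B →
      X.transition T x B ≤ X.transition T y B + ρ := by
  obtain ⟨T, -, hT⟩ := hX L hL
  lift X.doeblinCoeff T L to ℝ≥0 using (hT.trans ENNReal.one_lt_top).ne with ρ hρ
  refine ⟨T + 1, le_add_self, ρ, by exact_mod_cast hT, fun x hx y hy B hB => ?_⟩
  have key : ∀ B, MeasurableSet B → X.transition T x B ≤ X.transition T y B + ρ := fun B hB => by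
    refine (measure_le_add_of_varDist hB).trans (add_le_add le_rfl ?_)
    rw [hρ]
    exact le_iSup₂_of_le x hx (le_iSup₂_of_le y hy le_rfl)
  rw [transition_add, transition_add, Measure.bind_apply hB (Kernel.aemeasurable _),
    Measure.bind_apply hB (Kernel.aemeasurable _)]
  exact lintegral_le_add_of_measure_le_add key (Kernel.measurable_coe _ hB) fun _ => prob_le_one

end Doeblin

section Geometric

variable {E : Type*} [TopologicalSpace E] [PolishSpace E] [MeasurableSpace E] [BorelSpace E]
  [Nonempty E] (X : StrongMarkovProcess E)

/-- The constants are chosen in the order `R₀`, then `T` and `ρ₀`, then `β` and `ρ`. This is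
consistent because `γ` and `M` serve all times `t ≥ 1`, whatever `T` turns out to be. -/
theorem exists_geometric_coupling {g : E → ℝ≥0} (hg : Measurable g) (hg1 : ∀ x, 1 ≤ g x)
    {γ M : ℝ≥0} (hγ : γ < 1) (hM : ∀ t x, ∫⁻ y, g y ∂(X.transition t x) ≤ g x + M)
    (hγM : ∀ t, 1 ≤ t → ∀ x, ∫⁻ y, g y ∂(X.transition t x) ≤ γ * g x + M)
    (hD : ∀ R : ℝ≥0, ∃ T : ℝ≥0, 1 ≤ T ∧ ∃ ρ : ℝ≥0, ρ < 1 ∧ ∀ x y, g x ≤ R → g y ≤ R →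
      ∀ B, MeasurableSet B → X.transition T x B ≤ X.transition T y B + ρ) :
    ∃ R : Kernel (E × E) (CadlagPath E × CadlagPath E),
      (∀ p, (R p).map Prod.fst = X.law p.1) ∧ (∀ p, (R p).map Prod.snd = X.law p.2) ∧
      ∃ C ρ T : ℝ≥0, 0 < ρ ∧ ρ < 1 ∧ 0 < T ∧ ∀ (t : ℝ≥0) p,
        ∫⁻ z, {z : CadlagPath E × CadlagPath E | z.1 t ≠ z.2 t}.indicator
          (fun z => (g (z.1 t) + g (z.2 t) : ℝ≥0∞)) z ∂(R p) ≤
        C * ρ ^ ⌊t / T⌋₊ * (g p.1 + g p.2) := by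
  obtain ⟨R₀, hR₀⟩ := exists_contraction_constants γ M hγ
  obtain ⟨T, hT1, ρ₀, hρ₀, hTV⟩ := hD R₀
  obtain ⟨β, ρ, hβ, hρ0, hρ1, hcontr⟩ := hR₀ ρ₀ hρ₀
  have hT : 0 < T := zero_lt_one.trans_le hT1
  obtain ⟨Q, hQ1, hQ2, hQd, hQ⟩ := X.exists_stepCoupling T
  obtain ⟨R, hR1, hR2, hR⟩ := X.exists_iterated_coupling hT hQ1 hQ2
  have hg' : Measurable (fun x => (g x : ℝ≥0∞)) := hg.coe_nnreal_ennreal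
  have hne : MeasurableSet {p : E × E | p.1 ≠ p.2} :=
    (measurableSet_eq_fun measurable_fst measurable_snd).compl
  let D : E × E → ℝ≥0∞ := {p : E × E | p.1 ≠ p.2}.indicator
    (fun p => (1 + β * g p.1) + (1 + β * g p.2))
  let F : E × E → ℝ≥0∞ := {p : E × E | p.1 ≠ p.2}.indicator (fun p => g p.1 + g p.2)
  have hDm : Measurable D := Measurable.indicator (by fun_prop) hne
  have hFm : Measurable F := Measurable.indicator (by fun_prop) hne
  have hdiag : ∀ (t : ℝ≥0) x (f : E × E → ℝ≥0∞), Measurable f → (∀ y, f (y, y) = 0) →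
      ∫⁻ z, f (z.1 t, z.2 t) ∂(Q (x, x)) = 0 := by
    intro t x f hf h0
    have hm : Measurable (fun z : CadlagPath E × CadlagPath E => f (z.1 t, z.2 t)) :=
      hf.comp (((measurable_coord t).comp measurable_fst).prodMk
        ((measurable_coord t).comp measurable_snd))
    have hd : Measurable (fun ω : CadlagPath E => (ω, ω)) := measurable_id.prodMk measurable_id
    rw [hQd, lintegral_map hm hd]
    simp [h0]
  have hDd : ∀ y, D (y, y) = 0 := fun y => Set.indicator_of_notMem (by simp) _
  have hFd : ∀ y, F (y, y) = 0 := fun y => Set.indicator_of_notMem (by simp) _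
  have hDn : ∀ x y, x ≠ y → D (x, y) = ((2 + β * (g x + g y) : ℝ≥0) : ℝ≥0∞) := by
    intro x y hxy
    rw [show D (x, y) = (1 + β * g x) + (1 + β * g y) from Set.indicator_of_mem (by exact hxy) _]
    push_cast
    ring
  have hDρ : ∀ p, ∫⁻ z, D (z.1 T, z.2 T) ∂(Q p) ≤ ρ * D p := by
    rintro ⟨x, y⟩
    rcases eq_or_ne x y with rfl | hxy
    · rw [hdiag T x D hDm hDd]
      exact zero_le
    have hstep : ∀ κ : ℝ≥0, (∀ B, MeasurableSet B → X.transition T x B ≤ X.transition T y B + κ) →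
        ∫⁻ z, D (z.1 T, z.2 T) ∂(Q (x, y)) ≤
          ((2 * κ + β * (γ * (g x + g y) + 2 * M) : ℝ≥0) : ℝ≥0∞) := by
      intro κ hκ
      refine (hQ x y hxy κ hκ (fun u => β * g u) (hg'.const_mul _)).trans ?_
      rw [lintegral_const_mul _ hg', lintegral_const_mul _ hg']
      calc (2 * κ + (β * ∫⁻ u, g u ∂(X.transition T x) + β * ∫⁻ u, g u ∂(X.transition T y)) : ℝ≥0∞)
          ≤ 2 * κ + (β * (γ * g x + M) + β * (γ * g y + M)) := by
            gcongr
            · exact hγM T hT1 x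
            · exact hγM T hT1 y
        _ = ((2 * κ + β * (γ * (g x + g y) + 2 * M) : ℝ≥0) : ℝ≥0∞) := by
            push_cast
            ring
    rw [hDn x y hxy]
    by_cases hs : R₀ ≤ g x + g y
    -- Far from the centre the trivial total variation bound `1` suffices: the contraction comes
    -- from the drift.
    · refine (hstep 1 fun B _ => prob_le_one.trans le_add_self).trans ?_
      rw [mul_one]
      exact_mod_cast (hcontr (g x + g y)).1 hs
    · have hs' := (not_le.1 hs).le
      refine (hstep ρ₀ (hTV x y (le_self_add.trans hs') (le_add_self.trans hs'))).trans ?_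
      exact_mod_cast (hcontr (g x + g y)).2
  -- The factor `β⁻¹ + M` bounds the `g`-cost inside a block by `D` at its start, using `hM` since
  -- the elapsed time may be below one. The factor `1 + β` bounds `D` by `g + g`, using `g ≥ 1`.
  refine ⟨R, hR1, hR2, (β⁻¹ + M) * (1 + β), ρ, T, hρ0, hρ1, hT, fun t p => ?_⟩
  have hfin := hR D hDm ρ hDρ F hFm ((β⁻¹ + M : ℝ≥0) : ℝ≥0∞) t (fun q => ?_) p
  · refine hfin.trans ?_
    have hDp : D p ≤ ((1 + β) * (g p.1 + g p.2) : ℝ≥0) := by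
      by_cases hp : p.1 = p.2
      · rw [show D p = 0 from Set.indicator_of_notMem (by simpa using hp) _]
        exact zero_le
      · rw [show D p = _ from hDn p.1 p.2 hp, ENNReal.coe_le_coe, add_mul, one_mul]
        gcongr
        calc (2 : ℝ≥0) = 1 + 1 := by norm_num
          _ ≤ g p.1 + g p.2 := add_le_add (hg1 _) (hg1 _)
    calc ((β⁻¹ + M : ℝ≥0) : ℝ≥0∞) * (ρ ^ ⌊t / T⌋₊ * D p)
        ≤ ((β⁻¹ + M : ℝ≥0) : ℝ≥0∞) * (ρ ^ ⌊t / T⌋₊ * ((1 + β) * (g p.1 + g p.2) : ℝ≥0)) := by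
          gcongr
      _ = _ := by
          push_cast
          ring
  · obtain ⟨x, y⟩ := q
    set r := t - ⌊t / T⌋₊ * T
    rcases eq_or_ne x y with rfl | hxy
    · rw [hdiag r x F hFm hFd]
      exact zero_le
    have h1 : Measurable (fun z : CadlagPath E × CadlagPath E => (g (z.1 r) : ℝ≥0∞)) :=
      hg'.comp ((measurable_coord r).comp measurable_fst)
    have hgr : Measurable (fun ω : CadlagPath E => (g (ω r) : ℝ≥0∞)) :=
      hg'.comp (measurable_coord r)
    have e1 : ∫⁻ z, (g (z.1 r) : ℝ≥0∞) ∂(Q (x, y)) = ∫⁻ u, g u ∂(X.transition r x) := by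
      rw [lintegral_transition _ _ _ hg', ← hQ1 (x, y),
        lintegral_map hgr measurable_fst]
    have e2 : ∫⁻ z, (g (z.2 r) : ℝ≥0∞) ∂(Q (x, y)) = ∫⁻ u, g u ∂(X.transition r y) := by
      rw [lintegral_transition _ _ _ hg', ← hQ2 (x, y),
        lintegral_map hgr measurable_snd]
    rw [hDn x y hxy]
    calc ∫⁻ z, F (z.1 r, z.2 r) ∂(Q (x, y))
        ≤ ∫⁻ z, (g (z.1 r) + g (z.2 r)) ∂(Q (x, y)) :=
          lintegral_mono fun z => Set.indicator_le_self' (fun _ _ => zero_le) _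
      _ = ∫⁻ u, g u ∂(X.transition r x) + ∫⁻ u, g u ∂(X.transition r y) := by
          rw [lintegral_add_left h1, e1, e2]
      _ ≤ (g x + M) + (g y + M) := add_le_add (hM r x) (hM r y)
      _ ≤ ((β⁻¹ + M : ℝ≥0) : ℝ≥0∞) * ((2 + β * (g x + g y) : ℝ≥0) : ℝ≥0∞) := by
          have : (g x + M) + (g y + M) ≤ (β⁻¹ + M) * (2 + β * (g x + g y)) := by
            calc (g x + M) + (g y + M)
                ≤ β⁻¹ * 2 + M * (β * (g x + g y)) + ((g x + M) + (g y + M)) := le_add_self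
              _ = β⁻¹ * 2 + M * (β * (g x + g y)) + (β⁻¹ * β) * (g x + g y) + 2 * M := by
                  rw [inv_mul_cancel₀ hβ.ne']
                  ring
              _ = (β⁻¹ + M) * (2 + β * (g x + g y)) := by ring
          exact_mod_cast this

omit [Nonempty E] in
-- This is the coupling inequality: as `g ≥ 1`, the weighted cost dominates the probability that the
-- paths differ at time `t`.
theorem transition_le_add_of_coupling {g : E → ℝ≥0} (hg1 : ∀ x, 1 ≤ g x)
    {x y : E} {Q : Measure (CadlagPath E × CadlagPath E)}
    (hQ1 : Q.map Prod.fst = X.law x) (hQ2 : Q.map Prod.snd = X.law y) {t : ℝ≥0} {a : ℝ≥0∞}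
    (ha : ∫⁻ z, {z : CadlagPath E × CadlagPath E | z.1 t ≠ z.2 t}.indicator
      (fun z => (g (z.1 t) + g (z.2 t) : ℝ≥0∞)) z ∂Q ≤ a) {B : Set E} (hB : MeasurableSet B) :
    X.transition t x B ≤ X.transition t y B + a := by
  have h1 := measurable_coord (E := E) t
  have hne : MeasurableSet {z : CadlagPath E × CadlagPath E | z.1 t ≠ z.2 t} :=
    (measurableSet_eq_fun (h1.comp measurable_fst) (h1.comp measurable_snd)).compl
  rw [transition_apply, transition_apply, ← hQ1, ← hQ2, Measure.map_map h1 measurable_fst,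
    Measure.map_map h1 measurable_snd, Measure.map_apply (h1.comp measurable_fst) hB,
    Measure.map_apply (h1.comp measurable_snd) hB]
  refine le_trans ?_ (add_le_add le_rfl ha)
  refine (measure_mono ?_).trans ((measure_union_le _
    {z : CadlagPath E × CadlagPath E | z.1 t ≠ z.2 t}).trans (add_le_add le_rfl ?_))
  · intro z hz
    by_cases h : z.1 t = z.2 t
    · left
      change z.2 t ∈ B
      rw [← h]
      exact hz
    · exact Or.inr h
  · rw [← lintegral_indicator_one hne]
    refine lintegral_mono fun z => Set.indicator_le_indicator ?_
    change (1 : ℝ≥0∞) ≤ g (z.1 t) + g (z.2 t)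
    exact le_add_right (by exact_mod_cast hg1 _)

end Geometric

end StrongMarkovProcess

/-! ### Uniform limits and the invariant measure. -/

section UniformLimit

variable {S : Type*} [MeasurableSpace S]

/-- A sequence of probability measures which is Cauchy uniformly on measurable sets converges
uniformly to a probability measure. -/
theorem exists_measure_of_uniform_cauchy {μ : ℕ → Measure S} [∀ n, IsProbabilityMeasure (μ n)]
    {ε : ℕ → ℝ≥0∞} (hε : Tendsto ε atTop (𝓝 0))
    (h1 : ∀ n k B, MeasurableSet B → μ (n + k) B ≤ μ n B + ε n)
    (h2 : ∀ n k B, MeasurableSet B → μ n B ≤ μ (n + k) B + ε n) :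
    ∃ ν : Measure S, IsProbabilityMeasure ν ∧
      ∀ n B, MeasurableSet B → ν B ≤ μ n B + ε n ∧ μ n B ≤ ν B + ε n := by
  let m : Set S → ℝ≥0∞ := fun B => limsup (fun n => μ n B) atTop
  have hm1 : ∀ n B, MeasurableSet B → m B ≤ μ n B + ε n := fun n B hB =>
    limsup_le_of_le (by isBoundedDefault) <| (eventually_ge_atTop n).mono fun k hk => by
      obtain ⟨j, rfl⟩ := Nat.exists_eq_add_of_le hk
      exact h1 n j B hB
  have hle : ∀ n B, MeasurableSet B → μ n B ≤ liminf (fun n => μ n B) atTop + ε n := by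
    intro n B hB
    rw [← tsub_le_iff_right]
    refine le_liminf_of_le (by isBoundedDefault) <| (eventually_ge_atTop n).mono fun k hk => ?_
    obtain ⟨j, rfl⟩ := Nat.exists_eq_add_of_le hk
    rw [tsub_le_iff_right]
    exact h2 n j B hB
  have hε2 : Tendsto (fun n => ε n + ε n) atTop (𝓝 0) := by simpa using hε.add hε
  have hadd : ∀ {a b : ℝ≥0∞}, (∀ n, a ≤ b + (ε n + ε n)) → a ≤ b := fun {a b} h =>
    ge_of_tendsto' (by simpa using tendsto_const_nhds.add hε2) h
  have hm2 : ∀ n B, MeasurableSet B → μ n B ≤ m B + ε n := fun n B hB =>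
    (hle n B hB).trans (add_le_add (liminf_le_limsup) le_rfl)
  have hlim : ∀ B, MeasurableSet B → Tendsto (fun n => μ n B) atTop (𝓝 (m B)) := by
    intro B hB
    have hge : m B ≤ liminf (fun n => μ n B) atTop := hadd fun n => by
      rw [← add_assoc]
      exact (hm1 n B hB).trans (add_le_add (hle n B hB) le_rfl)
    exact tendsto_of_le_liminf_of_limsup_le hge le_rfl
  have hm0 : m ∅ = 0 := by simp [m]
  have hfin : ∀ (f : ℕ → Set S), (∀ i, MeasurableSet (f i)) → Pairwise (Function.onFun Disjoint f) →
      ∀ s : Finset ℕ, ∑ i ∈ s, m (f i) = m (⋃ i ∈ s, f i) := by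
    intro f hf hd s
    refine tendsto_nhds_unique (tendsto_finsetSum s fun i _ => hlim (f i) (hf i)) ?_
    refine (hlim _ (s.measurableSet_biUnion fun i _ => hf i)).congr fun n => ?_
    exact measure_biUnion_finset (fun i _ j _ hij => hd hij) fun i _ => hf i
  -- Countable additivity survives the limit because the error `ε n` is the same for the full union
  -- and for every finite subunion.
  have hU : ∀ ⦃f : ℕ → Set S⦄, (∀ i, MeasurableSet (f i)) → Pairwise (Function.onFun Disjoint f) →
      m (⋃ i, f i) = ∑' i, m (f i) := by
    intro f hf hd
    refine le_antisymm (hadd fun n => ?_) ?_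
    · rw [← add_assoc]
      refine (hm1 n _ (MeasurableSet.iUnion hf)).trans (add_le_add ?_ le_rfl)
      rw [measure_iUnion hd hf, ENNReal.tsum_eq_iSup_sum]
      refine iSup_le fun s => ?_
      rw [← measure_biUnion_finset (fun i _ j _ hij => hd hij) fun i _ => hf i]
      refine (hm2 n _ (s.measurableSet_biUnion fun i _ => hf i)).trans (add_le_add ?_ le_rfl)
      rw [← hfin f hf hd]
      exact ENNReal.sum_le_tsum s
    · rw [ENNReal.tsum_eq_iSup_sum]
      refine iSup_le fun s => ?_
      rw [hfin f hf hd]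
      refine limsup_le_limsup (Eventually.of_forall fun n => measure_mono ?_)
      exact Set.iUnion₂_subset fun i _ => Set.subset_iUnion f i
  let ν : Measure S := Measure.ofMeasurable (fun B _ => m B) hm0 hU
  have hν : ∀ B, MeasurableSet B → ν B = m B := fun B hB => Measure.ofMeasurable_apply B hB
  refine ⟨ν, ⟨?_⟩, fun n B hB => ?_⟩
  · rw [hν _ MeasurableSet.univ]
    simp [m]
  · rw [hν B hB]
    exact ⟨hm1 n B hB, hm2 n B hB⟩

/-- The truncations of `g` at `k`, rescaled to `[0, 1]`, pass to the limit; monotone convergence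
then removes the truncation. -/
theorem lintegral_le_of_tendsto_measure_le_add {μ : ℕ → Measure S} [∀ n, IsFiniteMeasure (μ n)]
    {ν : Measure S} [IsFiniteMeasure ν] {ε : ℕ → ℝ≥0∞} (hε : Tendsto ε atTop (𝓝 0))
    (h : ∀ n B, MeasurableSet B → ν B ≤ μ n B + ε n) {g : S → ℝ≥0∞} (hg : Measurable g)
    {a : ℝ≥0∞} (ha : ∀ n, ∫⁻ x, g x ∂(μ n) ≤ a) : ∫⁻ x, g x ∂ν ≤ a := by
  have hsup : ∀ x, g x = ⨆ k : ℕ, min (g x) k := fun x => by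
    rw [← inf_iSup_eq, ENNReal.iSup_natCast, inf_top_eq]
  have hmeas : ∀ k : ℕ, Measurable (fun x => min (g x) k) := fun k => hg.min measurable_const
  rw [lintegral_congr hsup, lintegral_iSup hmeas fun i j hij x => by
    dsimp only
    gcongr]
  refine iSup_le fun k => ?_
  rcases Nat.eq_zero_or_pos k with rfl | hk
  · simp
  have hk0 : (k : ℝ≥0∞) ≠ 0 := by exact_mod_cast hk.ne'
  have hkt : (k : ℝ≥0∞) ≠ ∞ := ENNReal.natCast_ne_top k
  have hmul : ∀ x, min (g x) k = k * ((k : ℝ≥0∞)⁻¹ * min (g x) k) := fun x => by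
    rw [← mul_assoc, ENNReal.mul_inv_cancel hk0 hkt, one_mul]
  have hf : Measurable (fun x => (k : ℝ≥0∞)⁻¹ * min (g x) k) := (hmeas k).const_mul _
  have hf1 : ∀ x, (k : ℝ≥0∞)⁻¹ * min (g x) k ≤ 1 := fun x => by
    rw [← ENNReal.inv_mul_cancel hk0 hkt]
    gcongr
    exact min_le_right _ _
  have hle : ∀ n, ∫⁻ x, min (g x) k ∂ν ≤ a + k * ε n := by
    intro n
    calc ∫⁻ x, min (g x) k ∂ν = k * ∫⁻ x, (k : ℝ≥0∞)⁻¹ * min (g x) k ∂ν := by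
          rw [← lintegral_const_mul _ hf]
          exact lintegral_congr hmul
      _ ≤ k * (∫⁻ x, (k : ℝ≥0∞)⁻¹ * min (g x) k ∂(μ n) + ε n) := by
          gcongr
          exact lintegral_le_add_of_measure_le_add (h n) hf hf1
      _ = ∫⁻ x, min (g x) k ∂(μ n) + k * ε n := by
          rw [mul_add, ← lintegral_const_mul _ hf, ← lintegral_congr hmul]
      _ ≤ a + k * ε n := by
          gcongr
          exact (lintegral_mono fun x => min_le_left _ _).trans (ha n)
  have hlim : Tendsto (fun n => a + k * ε n) atTop (𝓝 a) := by
    simpa using (tendsto_const_nhds (x := a)).add (ENNReal.Tendsto.const_mul hε (Or.inr hkt))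
  exact ge_of_tendsto' hlim hle

end UniformLimit

namespace StrongMarkovProcess

section Invariant

variable {E : Type*} [TopologicalSpace E] [MeasurableSpace E] (X : StrongMarkovProcess E)

/-- By Chapman–Kolmogorov, `P_{t+n}(x₀, ·)` averages `P_n(y, ·)` over `y ~ P_t(x₀, ·)`, so it
differs from `P_n(x₀, ·)` by at most `η n * (A + g x₀)`, uniformly in `t`. This yields both the
Cauchy property and, with real `t`, invariance of the limit. -/
theorem exists_isInvariant {g : E → ℝ≥0∞} (hg : Measurable g) {x₀ : E} {A : ℝ≥0∞} (hA : A ≠ ∞)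
    (hgA : ∀ t, ∫⁻ y, g y ∂(X.transition t x₀) ≤ A) (hx₀ : g x₀ ≠ ∞) {η : ℝ≥0 → ℝ≥0∞}
    (hη : Tendsto η atTop (𝓝 0)) (h : ∀ t x y B, MeasurableSet B →
      X.transition t x B ≤ X.transition t y B + η t * (g x + g y)) :
    ∃ π : Measure E, X.IsInvariant π ∧ ∫⁻ y, g y ∂π ≤ A := by
  let μ : ℕ → Measure E := fun n => X.transition n x₀
  let ε : ℕ → ℝ≥0∞ := fun n => η n * (A + g x₀)
  have hε : Tendsto ε atTop (𝓝 0) := by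
    have := ENNReal.Tendsto.mul_const (b := A + g x₀) (hη.comp tendsto_natCast_atTop_atTop)
      (Or.inr (ENNReal.add_ne_top.2 ⟨hA, hx₀⟩))
    rw [zero_mul] at this
    exact this
  have hbind : ∀ (n : ℕ) (t : ℝ≥0) B, MeasurableSet B →
      X.transition (t + n) x₀ B = ∫⁻ y, X.transition n y B ∂(X.transition t x₀) := by
    intro n t B hB
    rw [transition_add, Measure.bind_apply hB (Kernel.aemeasurable _)]
  have hint : ∀ (n : ℕ) (t : ℝ≥0), ∫⁻ y, η n * (g y + g x₀) ∂(X.transition t x₀) ≤ ε n := by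
    intro n t
    rw [lintegral_const_mul _ (hg.add_const _), lintegral_add_left hg, lintegral_const,
      measure_univ, mul_one]
    exact mul_le_mul_right (add_le_add (hgA t) le_rfl) _
  have hup : ∀ (n : ℕ) (t : ℝ≥0) B, MeasurableSet B →
      X.transition (t + n) x₀ B ≤ μ n B + ε n := by
    intro n t B hB
    rw [hbind n t B hB]
    calc ∫⁻ y, X.transition n y B ∂(X.transition t x₀)
        ≤ ∫⁻ y, (μ n B + η n * (g y + g x₀)) ∂(X.transition t x₀) :=
          lintegral_mono fun y => h n y x₀ B hB
      _ ≤ μ n B + ε n := by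
          rw [lintegral_add_left measurable_const, lintegral_const, measure_univ, mul_one]
          exact add_le_add le_rfl (hint n t)
  have hdown : ∀ (n : ℕ) (t : ℝ≥0) B, MeasurableSet B →
      μ n B ≤ X.transition (t + n) x₀ B + ε n := by
    intro n t B hB
    rw [hbind n t B hB]
    calc μ n B = ∫⁻ y, μ n B ∂(X.transition t x₀) := by
          rw [lintegral_const, measure_univ, mul_one]
      _ ≤ ∫⁻ y, (X.transition n y B + η n * (g y + g x₀)) ∂(X.transition t x₀) :=
          lintegral_mono fun y => by
            rw [add_comm (g y)]
            exact h n x₀ y B hB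
      _ ≤ _ := by
          rw [lintegral_add_left (Kernel.measurable_coe _ hB)]
          exact add_le_add le_rfl (hint n t)
  have hcast : ∀ n k : ℕ, μ (n + k) = X.transition ((k : ℝ≥0) + n) x₀ := fun n k => by
    change X.transition ((n + k : ℕ) : ℝ≥0) x₀ = _
    rw [Nat.cast_add, add_comm]
  obtain ⟨π, hπ, hπμ⟩ := exists_measure_of_uniform_cauchy (μ := μ) hε
    (fun n k B hB => by rw [hcast]; exact hup n k B hB)
    (fun n k B hB => by rw [hcast]; exact hdown n k B hB)
  have hε3 : Tendsto (fun n => ε n + ε n + ε n) atTop (𝓝 0) := by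
    simpa using (hε.add hε).add hε
  have hclose : ∀ {a b : ℝ≥0∞}, (∀ n, a ≤ b + (ε n + ε n + ε n)) → a ≤ b := fun {a b} h =>
    ge_of_tendsto' (by simpa using tendsto_const_nhds.add hε3) h
  refine ⟨π, ⟨hπ, fun t => ?_⟩, lintegral_le_of_tendsto_measure_le_add hε
    (fun n B hB => (hπμ n B hB).1) hg fun n => hgA n⟩
  ext B hB
  have hmeas : Measurable (fun y => X.transition t y B) := Kernel.measurable_coe _ hB
  have hbind' : ∀ n : ℕ, ∫⁻ y, X.transition t y B ∂(μ n) = X.transition (t + n) x₀ B := by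
    intro n
    rw [add_comm, transition_add, Measure.bind_apply hB (Kernel.aemeasurable _)]
  rw [Measure.bind_apply hB (Kernel.aemeasurable _)]
  -- Three errors: from `πP_t` to `μ_n P_t`, from there to `μ_n`, and from `μ_n` to `π`.
  refine le_antisymm (hclose fun n => ?_) (hclose fun n => ?_)
  · calc ∫⁻ y, X.transition t y B ∂π ≤ ∫⁻ y, X.transition t y B ∂(μ n) + ε n :=
          lintegral_le_add_of_measure_le_add (fun B hB => (hπμ n B hB).1) hmeas
            fun _ => prob_le_one
      _ ≤ (π B + ε n + ε n) + ε n := by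
          rw [hbind']
          exact add_le_add ((hup n t B hB).trans (add_le_add (hπμ n B hB).2 le_rfl)) le_rfl
      _ = _ := by ring
  · calc π B ≤ μ n B + ε n := (hπμ n B hB).1
      _ ≤ (∫⁻ y, X.transition t y B ∂(μ n) + ε n) + ε n := by
          rw [hbind']
          exact add_le_add (hdown n t B hB) le_rfl
      _ ≤ ((∫⁻ y, X.transition t y B ∂π + ε n) + ε n) + ε n := by
          gcongr
          exact lintegral_le_add_of_measure_le_add (fun B hB => (hπμ n B hB).2) hmeas
            fun _ => prob_le_one
      _ = _ := by ring

end Invariant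

end StrongMarkovProcess

/-! ### From geometric decay to the exponential coupling. -/

/-- Since `t / T ≤ ⌊t / T⌋ + 1`, rounding costs one factor `ρ⁻¹`. -/
theorem pow_floor_div_le {ρ : ℝ} (hρ : 0 < ρ) (hρ1 : ρ < 1) {T : ℝ≥0} (hT : 0 < T) (t : ℝ≥0) :
    ρ ^ ⌊t / T⌋₊ ≤ ρ⁻¹ * Real.exp (-(-Real.log ρ / T) * t) := by
  have hT' : (0 : ℝ) < T := hT
  have h : (t : ℝ) / T ≤ (⌊t / T⌋₊ + 1 : ℕ) := by
    exact_mod_cast (Nat.lt_floor_add_one (t / T)).le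
  have e : Real.exp (-(-Real.log ρ / T) * t) = ρ ^ ((t : ℝ) / T) := by
    rw [Real.rpow_def_of_pos hρ]
    congr 1
    ring
  rw [e, inv_mul_eq_div, le_div_iff₀ hρ, ← pow_succ, ← Real.rpow_natCast]
  exact Real.rpow_le_rpow_of_exponent_ge hρ hρ1.le h

theorem exists_isCompact_sublevel {E : Type*} [TopologicalSpace E] {φ : E → ℝ}
    (h : Tendsto φ (cocompact E) atTop) (c : ℝ) : ∃ L, IsCompact L ∧ ∀ x, φ x ≤ c → x ∈ L := by
  obtain ⟨L, hL, hLc⟩ := mem_cocompact.1 (h.eventually_gt_atTop c)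
  exact ⟨L, hL, fun x hx => by_contra fun hxL => not_lt.2 hx (hLc hxL)⟩

theorem sigmaCompactSpace_of_tendsto_cocompact {E : Type*} [TopologicalSpace E] {φ : E → ℝ}
    (h : Tendsto φ (cocompact E) atTop) : SigmaCompactSpace E := by
  choose L hL hφL using fun n : ℕ => exists_isCompact_sublevel h n
  refine ⟨⟨L, hL, Set.eq_univ_of_forall fun x => ?_⟩⟩
  obtain ⟨n, hn⟩ := exists_nat_ge (φ x)
  exact Set.mem_iUnion.2 ⟨n, hφL n x hn⟩

namespace StrongMarkovProcess

section ExpCoupling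

variable {E : Type*} [TopologicalSpace E] [MeasurableSpace E] (X : StrongMarkovProcess E)

/-- Averaging over the second starting point turns couplings of trajectories started from two points
into a coupling with the stationary process. -/
theorem isCoupling_bind {R : Kernel (E × E) (CadlagPath E × CadlagPath E)}
    (hR1 : ∀ p, (R p).map Prod.fst = X.law p.1) (hR2 : ∀ p, (R p).map Prod.snd = X.law p.2)
    (x : E) (π : Measure E) [IsProbabilityMeasure π] :
    X.IsCoupling (Measure.dirac x) π
      (π.bind (R.comap (fun y => (x, y)) measurable_prodMk_left)) := by
  refine ⟨?_, ?_⟩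
  · ext B hB
    rw [Measure.map_apply measurable_fst hB,
      Measure.bind_apply (measurable_fst hB) (Kernel.aemeasurable _), lawFrom,
      Measure.dirac_bind X.law.measurable]
    have : ∀ y, R.comap (fun y => (x, y)) measurable_prodMk_left y (Prod.fst ⁻¹' B) =
        X.law x B := fun y => by
      rw [Kernel.comap_apply, ← Measure.map_apply measurable_fst hB, hR1]
    rw [lintegral_congr this, lintegral_const, measure_univ, mul_one]
  · ext B hB
    rw [Measure.map_apply measurable_snd hB,
      Measure.bind_apply (measurable_snd hB) (Kernel.aemeasurable _), lawFrom,
      Measure.bind_apply hB (Kernel.aemeasurable _)]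
    refine lintegral_congr fun y => ?_
    rw [Kernel.comap_apply, ← Measure.map_apply measurable_snd hB, hR2]

/-- A single level `c` with tails at most `1` is enough: below it `φ ≤ c`. -/
theorem exists_lintegral_le_of_tail {φ : E → ℝ} {K : Set E}
    (h : Tendsto (fun c : ℝ => ⨆ x ∈ K, ⨆ t : ℝ≥0,
        ∫⁻ ω, {ω | c < φ (ω t)}.indicator
          (fun ω => ENNReal.ofReal (φ (ω t))) ω ∂(X.law x)) atTop (𝓝 0)) :
    ∃ M : ℝ≥0, ∀ y ∈ K, ∀ s : ℝ≥0, ∫⁻ ω, ENNReal.ofReal (φ (ω s)) ∂(X.law y) ≤ M := by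
  obtain ⟨c, hc⟩ := (h.eventually_le_const zero_lt_one).exists
  refine ⟨c.toNNReal + 1, fun y hy s => ?_⟩
  have hy' : ∫⁻ ω, {ω : CadlagPath E | c < φ (ω s)}.indicator
      (fun ω => ENNReal.ofReal (φ (ω s))) ω ∂(X.law y) ≤ 1 :=
    (iSup_le_iff.1 (iSup₂_le_iff.1 hc y hy)) s
  calc ∫⁻ ω, ENNReal.ofReal (φ (ω s)) ∂(X.law y)
      ≤ ∫⁻ ω, (ENNReal.ofReal c + {ω : CadlagPath E | c < φ (ω s)}.indicator
          (fun ω => ENNReal.ofReal (φ (ω s))) ω) ∂(X.law y) := by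
        refine lintegral_mono fun ω => ?_
        by_cases hω : c < φ (ω s)
        · rw [Set.indicator_of_mem (by exact hω)]
          exact le_add_self
        · exact (ENNReal.ofReal_le_ofReal (not_lt.1 hω)).trans le_self_add
    _ ≤ ENNReal.ofReal c + 1 := by
        rw [lintegral_add_left measurable_const, lintegral_const, measure_univ, mul_one]
        exact add_le_add le_rfl hy'
    _ = ((c.toNNReal + 1 : ℝ≥0) : ℝ≥0∞) := by
        push_cast
        rfl

/-- The coupling bound yields `π` with `∫ φ dπ ≤ A`, and averaging over `y ~ π` replaces `φ(y)` by
`A`. Then `φ ≥ 1` absorbs `A` into a multiple of `φ(x)`. -/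
theorem admitsExpCoupling_of_geometric [Nonempty E] [PolishSpace E] [BorelSpace E]
    {φ : E → ℝ} (hφ : Measurable φ) (hφ1 : ∀ x, 1 ≤ φ x)
    {M : ℝ≥0} (hM : ∀ t x, ∫⁻ y, ENNReal.ofReal (φ y) ∂(X.transition t x) ≤
      ENNReal.ofReal (φ x) + M)
    {R : Kernel (E × E) (CadlagPath E × CadlagPath E)}
    (hR1 : ∀ p, (R p).map Prod.fst = X.law p.1) (hR2 : ∀ p, (R p).map Prod.snd = X.law p.2)
    {C b : ℝ} (hC : 0 ≤ C) (hb : 0 < b)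
    (hR : ∀ (t : ℝ≥0) p, ∫⁻ z, {z : CadlagPath E × CadlagPath E | z.1 t ≠ z.2 t}.indicator
      (fun z => ENNReal.ofReal (φ (z.1 t)) + ENNReal.ofReal (φ (z.2 t))) z ∂(R p) ≤
        ENNReal.ofReal (C * Real.exp (-b * t)) *
          (ENNReal.ofReal (φ p.1) + ENNReal.ofReal (φ p.2))) :
    X.AdmitsExpCoupling φ := by
  have hg : Measurable (fun x => ENNReal.ofReal (φ x)) := hφ.ennreal_ofReal
  have hη : Tendsto (fun t : ℝ≥0 => ENNReal.ofReal (C * Real.exp (-b * t))) atTop (𝓝 0) := by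
    have h1 : Tendsto (fun t : ℝ≥0 => -b * (t : ℝ)) atTop atBot :=
      (NNReal.tendsto_coe_atTop.2 tendsto_id).const_mul_atTop_of_neg (by linarith)
    have h2 := ENNReal.tendsto_ofReal ((Real.tendsto_exp_atBot.comp h1).const_mul C)
    simpa using h2
  obtain ⟨x₀⟩ := ‹Nonempty E›
  set A : ℝ := φ x₀ + M with hA
  have hA0 : 0 ≤ A := add_nonneg (zero_le_one.trans (hφ1 _)) M.coe_nonneg
  have hAe : ENNReal.ofReal A = ENNReal.ofReal (φ x₀) + M := by
    rw [hA, ENNReal.ofReal_add (zero_le_one.trans (hφ1 _)) M.coe_nonneg, ENNReal.ofReal_coe_nnreal]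
  obtain ⟨π, hπ, hπg⟩ := X.exists_isInvariant hg (x₀ := x₀) (A := ENNReal.ofReal A)
    ENNReal.ofReal_ne_top (fun t => hAe ▸ hM t x₀) ENNReal.ofReal_ne_top hη fun t x y B hB =>
      X.transition_le_add_of_coupling (g := fun x => (φ x).toNNReal)
        (fun x => Real.one_le_toNNReal.2 (hφ1 x)) (hR1 (x, y)) (hR2 (x, y)) (hR t (x, y)) hB
  have hπP := hπ.1
  -- The summand `1` keeps the constant positive, as `C` may be zero.
  refine ⟨π, hπ, C * (1 + A) + 1, b, by positivity, hb, fun x =>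
    ⟨_, X.isCoupling_bind hR1 hR2 x π, fun t => ?_⟩⟩
  have hadd : ∀ u v, ENNReal.ofReal (φ u + φ v) = ENNReal.ofReal (φ u) + ENNReal.ofReal (φ v) :=
    fun u v => ENNReal.ofReal_add (zero_le_one.trans (hφ1 _)) (zero_le_one.trans (hφ1 _))
  simp only [hadd]
  have h1 : Measurable (fun z : CadlagPath E × CadlagPath E => z.1 t) :=
    (measurable_coord t).comp measurable_fst
  have h2 : Measurable (fun z : CadlagPath E × CadlagPath E => z.2 t) :=
    (measurable_coord t).comp measurable_snd
  have hF : Measurable ({z : CadlagPath E × CadlagPath E | z.1 t ≠ z.2 t}.indicator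
      (fun z => ENNReal.ofReal (φ (z.1 t)) + ENNReal.ofReal (φ (z.2 t)))) :=
    ((hg.comp h1).add (hg.comp h2)).indicator (measurableSet_eq_fun h1 h2).compl
  rw [Measure.lintegral_bind (Kernel.aemeasurable _) hF.aemeasurable]
  calc ∫⁻ y, ∫⁻ z, {z : CadlagPath E × CadlagPath E | z.1 t ≠ z.2 t}.indicator
        (fun z => ENNReal.ofReal (φ (z.1 t)) + ENNReal.ofReal (φ (z.2 t))) z
          ∂(R.comap (fun y => (x, y)) measurable_prodMk_left y) ∂π
      ≤ ∫⁻ y, ENNReal.ofReal (C * Real.exp (-b * t)) *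
          (ENNReal.ofReal (φ x) + ENNReal.ofReal (φ y)) ∂π := by
        refine lintegral_mono fun y => ?_
        rw [Kernel.comap_apply]
        exact hR t (x, y)
    _ ≤ ENNReal.ofReal (C * Real.exp (-b * t)) * (ENNReal.ofReal (φ x) + ENNReal.ofReal A) := by
        rw [lintegral_const_mul _ (hg.const_add _), lintegral_add_left measurable_const,
          lintegral_const, measure_univ, mul_one]
        gcongr
    _ = ENNReal.ofReal (C * Real.exp (-b * t) * (φ x + A)) := by
        rw [ENNReal.ofReal_mul (mul_nonneg hC (Real.exp_pos _).le),
          ENNReal.ofReal_add (zero_le_one.trans (hφ1 _)) hA0]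
    _ ≤ ENNReal.ofReal ((C * (1 + A) + 1) * Real.exp (-b * t) * φ x) := by
        refine ENNReal.ofReal_le_ofReal ?_
        have hx := hφ1 x
        have he := Real.exp_pos (-b * t)
        calc C * Real.exp (-b * t) * (φ x + A) ≤ C * Real.exp (-b * t) * (φ x + A * φ x) := by
              gcongr
              exact le_mul_of_one_le_right hA0 hx
          _ = C * (1 + A) * Real.exp (-b * t) * φ x := by ring
          _ ≤ (C * (1 + A) + 1) * Real.exp (-b * t) * φ x := by
              gcongr
              linarith

end ExpCoupling

end StrongMarkovProcess

end PhiCoupling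

end

theorem theorem2p1 {E : Type*} [MetricSpace E] [LocallyCompactSpace E] [Nonempty E]
    [MeasurableSpace E] [BorelSpace E]
    (X : PhiCoupling.StrongMarkovProcess E) (hX : X.LocalDoeblin)
    (φ : E → ℝ) (hφ_meas : Measurable φ) (hφ_one : ∀ x, 1 ≤ φ x)
    (K : Set E) (hK : IsCompact K) (α : ℝ) (hα : 0 < α)
    (h1 : Tendsto φ (cocompact E) atTop)
    (h2 : ∀ (x : E) (t : ℝ≥0),
      ∫⁻ ω, {ω | (t : WithTop ℝ≥0) < PhiCoupling.hitTime K ω}.indicator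
          (fun ω => ENNReal.ofReal (φ (ω t))) ω ∂(X.law x)
        ≤ ENNReal.ofReal (Real.exp (-α * t) * φ x))
    (h3 : Tendsto (fun c : ℝ => ⨆ x ∈ K, ⨆ t : ℝ≥0,
        ∫⁻ ω, {ω | c < φ (ω t)}.indicator
          (fun ω => ENNReal.ofReal (φ (ω t))) ω ∂(X.law x))
      atTop (𝓝 0)) :
    X.AdmitsExpCoupling φ := by
  -- The sublevel sets of `φ` lie in compact sets, so `E` is σ-compact and, being metric, second
  -- countable.
  have hσ := PhiCoupling.sigmaCompactSpace_of_tendsto_cocompact h1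
  have hE : PolishSpace E := PhiCoupling.polishSpace_of_locallyCompactSpace E
  have hφ0 : ∀ x, 0 ≤ φ x := fun x => zero_le_one.trans (hφ_one x)
  have hg : Measurable (fun x => ENNReal.ofReal (φ x)) := hφ_meas.ennreal_ofReal
  obtain ⟨M, hM⟩ := X.exists_lintegral_le_of_tail h3
  have hL : ∀ (t : ℝ≥0) x, ∫⁻ y, ENNReal.ofReal (φ y) ∂(X.transition t x) ≤
      ENNReal.ofReal (Real.exp (-α * t) * φ x) + M := fun t x =>
    X.lintegral_transition_le hK.isClosed hg hM x t (h2 x t)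
  have hL1 : ∀ (t : ℝ≥0) x, ∫⁻ y, ENNReal.ofReal (φ y) ∂(X.transition t x) ≤
      ENNReal.ofReal (φ x) + M := fun t x => by
    refine (hL t x).trans (add_le_add (ENNReal.ofReal_le_ofReal ?_) le_rfl)
    refine mul_le_of_le_one_left (hφ0 x) (Real.exp_le_one_iff.2 ?_)
    have := mul_nonneg hα.le t.coe_nonneg
    rw [neg_mul]
    exact neg_nonpos.2 this
  have hLγ : ∀ t : ℝ≥0, 1 ≤ t → ∀ x, ∫⁻ y, ENNReal.ofReal (φ y) ∂(X.transition t x) ≤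
      (Real.exp (-α)).toNNReal * ENNReal.ofReal (φ x) + M := fun t ht x => by
    refine (hL t x).trans (add_le_add ?_ le_rfl)
    rw [ENNReal.ofReal_mul (Real.exp_pos _).le]
    refine mul_le_mul_left (ENNReal.ofReal_le_ofReal (Real.exp_le_exp.2 ?_)) _
    have ht' : (1 : ℝ) ≤ t := ht
    nlinarith
  have hγ : (Real.exp (-α)).toNNReal < 1 := by
    rw [Real.toNNReal_lt_one, Real.exp_lt_one_iff]
    linarith
  obtain ⟨R, hR1, hR2, C, ρ, T, hρ0, hρ1, hT, hR⟩ := X.exists_geometric_coupling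
    (g := fun x => (φ x).toNNReal) hφ_meas.real_toNNReal
    (fun x => Real.one_le_toNNReal.2 (hφ_one x)) hγ hL1 hLγ fun c => by
      obtain ⟨L, hLc, hφL⟩ := PhiCoupling.exists_isCompact_sublevel h1 c
      obtain ⟨T, hT, ρ, hρ, hTV⟩ := X.exists_transition_le_add hX hLc
      exact ⟨T, hT, ρ, hρ, fun x y hx hy => hTV x (hφL x (Real.toNNReal_le_iff_le_coe.1 hx))
        y (hφL y (Real.toNNReal_le_iff_le_coe.1 hy))⟩
  have hρ0' : (0 : ℝ) < ρ := hρ0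
  have hρ1' : (ρ : ℝ) < 1 := hρ1
  have hT' : (0 : ℝ) < T := hT
  -- The rate `-log ρ / T` spreads one contraction by `ρ` over a block of length `T`; the factor
  -- `ρ⁻¹` pays for the incomplete block.
  refine X.admitsExpCoupling_of_geometric hφ_meas hφ_one hL1 hR1 hR2 (C := C * (ρ : ℝ)⁻¹)
    (b := -Real.log ρ / T) (by positivity)
    (div_pos (neg_pos.2 (Real.log_neg hρ0' hρ1')) hT') fun t p => ?_
  refine (hR t p).trans (mul_le_mul_left ?_ _)
  rw [mul_assoc, ENNReal.ofReal_mul C.coe_nonneg, ENNReal.ofReal_coe_nnreal]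
  refine mul_le_mul_right ?_ _
  rw [← ENNReal.ofReal_coe_nnreal, ← ENNReal.ofReal_pow hρ0'.le]
  exact ENNReal.ofReal_le_ofReal (PhiCoupling.pow_floor_div_le hρ0' hρ1' hT t)
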